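/- Let $G$ be a finite connected graph (loops and multiple edges allowed) with edge set $E$, each edge being identified with $[0,1]$. A metric on $G$ is a vector $g\in\mathbb{R}_{+}^{E}$, which gives the edge $e$ the length $\sqrt{g_e}$; put $L(g)=\sum_{e}\sqrt{g_e}$. A density is a function $\rho$ on the edges with every $\rho_e$ positive and smooth on $[0,1]$; put $\int_{(G,g)}\rho\,dx=\sum_e\sqrt{g_e}\int_0^1\rho_e(x)\,dx$. Let $0=\lambda_0(g,\rho)<\lambda_1(g,\rho)\le\lambda_2(g,\rho)\le\cdots$ be the eigenvalues, repeated according to multiplicity, of the problem $-\frac{1}{g_e}f_e''=\lambda\rho_e f_e$ on every edge $e$, $f$ continuous on $G$, and at every vertex the sum of the arc-length derivatives of $f$ in the directions pointing into the attached edges equals $0$. Put $\lambda_k(g)=\lambda_k(g,1)$ and $$\overline{\lambda_k}(g,\rho)=\lambda_k(g,\rho)\,L(g)\int_{(G,g)}\rho\,dx,\qquad \overline{\lambda_k}(g)=\lambda_k(g)\,L(g)^2 .$$ A pair $(g_*,\rho_*)$ of a metric and a density is called extremal for a functional $F(g,\rho)$ if for every smooth one-parameter family $(g(t),\rho(t))$,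 $|t|<\varepsilon$, of metrics and densities (with $\rho(t)_e(x)$ smooth jointly in $(t,x)$) such that $(g(0),\rho(0))=(g_*,\rho_*)$, either $F(g(t),\rho(t))\le F(g_*,\rho_*)+o(t)$ or $F(g(t),\rho(t))\ge F(g_*,\rho_*)+o(t)$ as $t\to0$. A metric $g_*$ is called extremal for a functional $F(g)$ if the same holds for all smooth one-parameter families of metrics $g(t)$ with $g(0)=g_*$. Let $k\ge 1$ and suppose that $(g_*,\rho_*)$ is extremal for the functional $\overline{\lambda_k}(g,\rho)$. Then $\rho_*$ is a constant function and $g_*$ is extremal for the functional $\overline{\lambda_k}(g)$. -/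

import Mathlib

open Set Filter Topology Asymptotics
open scoped ContDiff unitInterval

noncomputable section

/-- A multigraph (loops and multiple edges allowed) with vertices `V` and edges `E`.  Every edge
is identified with `[0,1]`; `src e` is the endpoint at `x = 0` and `tgt e` the endpoint at `x = 1`.
The direction of an edge is only a choice of parametrisation. -/
structure Multigraph (V E : Type*) where
  src : E → V
  tgt : E → V

namespace Multigraph

variable {V E : Type*}

/-- The graph has a vertex, and any two vertices are joined by a walk that may traverse
edges in both directions. -/
def Connected (G : Multigraph V E) : Prop :=
  Nonempty V ∧ ∀ u v : V, Relation.EqvGen (fun a b => ∃ e, G.src e = a ∧ G.tgt e = b) u v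

end Multigraph

namespace QuantumGraph

variable {V E : Type*}

/-- A real function on the (closed, disjoint) edges `[0,1]` of the graph. -/
abbrev EdgeFun (E : Type*) : Type _ := E → I → ℝ

/-- The restriction of `f` to the edge `e`, as a function of a real variable.  Only its values
and its one-sided derivatives on `[0,1]` are ever used. -/
def onEdge (f : EdgeFun E) (e : E) : ℝ → ℝ := IccExtend zero_le_one (f e)

/-- The derivative `df_e/dx` on `[0,1]`, one-sided at the endpoints. -/
def edgeDeriv (f : EdgeFun E) (e : E) (x : ℝ) : ℝ :=
  derivWithin (onEdge f e) (Icc 0 1) x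

/-- The second derivative `d²f_e/dx²` on `[0,1]`, one-sided at the endpoints. -/
def edgeDeriv2 (f : EdgeFun E) (e : E) (x : ℝ) : ℝ :=
  iteratedDerivWithin 2 (onEdge f e) (Icc 0 1) x

lemma onEdge_add (f h : EdgeFun E) (e : E) : onEdge (f + h) e = onEdge f e + onEdge h e := rfl

lemma onEdge_smul (c : ℝ) (f : EdgeFun E) (e : E) : onEdge (c • f) e = c • onEdge f e := rfl

lemma onEdge_zero (e : E) : onEdge (0 : EdgeFun E) e = 0 := rfl

/-- `f` is well defined and continuous across the vertices: all edge ends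
that meet at a vertex carry the same value. -/
def MatchesAtVertices (G : Multigraph V E) (f : EdgeFun E) : Prop :=
  ∃ φ : V → ℝ, ∀ e, f e 0 = φ (G.src e) ∧ f e 1 = φ (G.tgt e)

open Classical in
/-- The sum over all edge ends at `v` of the derivatives of `f` at `v` in the direction pointing
into the edge, with respect to arc length (the edge `e` has length `√(g e)`).  A loop at `v`
contributes both of its ends. -/
def kirchhoffSum [Fintype E] (G : Multigraph V E) (g : E → ℝ) (f : EdgeFun E) (v : V) : ℝ :=
  ∑ e, ((if G.src e = v then edgeDeriv f e 0 / √(g e) else 0)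
    + (if G.tgt e = v then -(edgeDeriv f e 1 / √(g e)) else 0))

lemma edgeDeriv_add {f h : EdgeFun E} {e : E} (hf : ContDiffOn ℝ 2 (onEdge f e) (Icc 0 1))
    (hh : ContDiffOn ℝ 2 (onEdge h e) (Icc 0 1)) {x : ℝ} (hx : x ∈ Icc (0 : ℝ) 1) :
    edgeDeriv (f + h) e x = edgeDeriv f e x + edgeDeriv h e x := by
  unfold edgeDeriv
  rw [onEdge_add]
  exact derivWithin_add (hf.differentiableOn (by norm_num) x hx)
    (hh.differentiableOn (by norm_num) x hx)

lemma edgeDeriv_smul (c : ℝ) {f : EdgeFun E} {e : E}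
    (hf : ContDiffOn ℝ 2 (onEdge f e) (Icc 0 1)) {x : ℝ} (hx : x ∈ Icc (0 : ℝ) 1) :
    edgeDeriv (c • f) e x = c * edgeDeriv f e x := by
  unfold edgeDeriv
  rw [onEdge_smul, derivWithin_const_smul c (hf.differentiableOn (by norm_num) x hx), smul_eq_mul]

/-- The space of solutions of the eigenvalue problem with density `ρ` on `(G, g)`:
`-(1/g_e) f_e'' = μ ρ_e f_e` on every edge, `f` continuous on the graph, and the derivatives at
every vertex sum to zero. -/
def eigenspace [Fintype E] (G : Multigraph V E) (g : E → ℝ) (ρ : EdgeFun E) (μ : ℝ) :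
    Submodule ℝ (EdgeFun E) where
  carrier := {f | (∀ e, ContDiffOn ℝ 2 (onEdge f e) (Icc 0 1)) ∧
    (∀ e, ∀ x : I, -(1 / g e) * edgeDeriv2 f e x = μ * ρ e x * f e x) ∧
    MatchesAtVertices G f ∧
    ∀ v, kirchhoffSum G g f v = 0}
  zero_mem' := by
    refine ⟨fun e => ?_, fun e x => ?_, ⟨0, fun e => ⟨rfl, rfl⟩⟩, fun v => ?_⟩
    · rw [onEdge_zero]; exact contDiffOn_const
    · have : edgeDeriv2 (0 : EdgeFun E) e x = 0 := by
        unfold edgeDeriv2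
        rw [onEdge_zero]
        exact iteratedDerivWithin_const_zero
      simp [this]
    · have : ∀ e x, edgeDeriv (0 : EdgeFun E) e x = 0 := by
        intro e x
        unfold edgeDeriv
        rw [onEdge_zero]
        simp
      simp [kirchhoffSum, this]
  add_mem' := by
    rintro f h ⟨hf1, hf2, ⟨φ, hφ⟩, hf4⟩ ⟨hh1, hh2, ⟨ψ, hψ⟩, hh4⟩
    refine ⟨fun e => ?_, fun e x => ?_, ⟨φ + ψ, fun e => ⟨?_, ?_⟩⟩, fun v => ?_⟩
    · rw [onEdge_add]; exact (hf1 e).add (hh1 e)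
    · have : edgeDeriv2 (f + h) e x = edgeDeriv2 f e x + edgeDeriv2 h e x := by
        unfold edgeDeriv2
        rw [onEdge_add]
        exact iteratedDerivWithin_add x.2 (uniqueDiffOn_Icc zero_lt_one) (hf1 e x x.2)
          (hh1 e x x.2)
      rw [this, mul_add, hf2, hh2]
      simp only [Pi.add_apply]
      ring
    · simp [(hφ e).1, (hψ e).1]
    · simp [(hφ e).2, (hψ e).2]
    · have : kirchhoffSum G g (f + h) v = kirchhoffSum G g f v + kirchhoffSum G g h v := by
        unfold kirchhoffSum
        rw [← Finset.sum_add_distrib]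
        refine Finset.sum_congr rfl fun e _ => ?_
        rw [edgeDeriv_add (hf1 e) (hh1 e) (by simp), edgeDeriv_add (hf1 e) (hh1 e) (by simp)]
        split_ifs <;> ring
      rw [this, hf4, hh4, add_zero]
  smul_mem' := by
    rintro c f ⟨hf1, hf2, ⟨φ, hφ⟩, hf4⟩
    refine ⟨fun e => ?_, fun e x => ?_, ⟨c • φ, fun e => ⟨?_, ?_⟩⟩, fun v => ?_⟩
    · rw [onEdge_smul]; exact (hf1 e).const_smul c
    · have : edgeDeriv2 (c • f) e x = c * edgeDeriv2 f e x := by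
        unfold edgeDeriv2
        rw [onEdge_smul]
        exact iteratedDerivWithin_const_smul x.2 (uniqueDiffOn_Icc zero_lt_one) c (hf1 e x x.2)
      rw [this, mul_left_comm, hf2]
      simp only [Pi.smul_apply, smul_eq_mul]
      ring
    · simp [(hφ e).1]
    · simp [(hφ e).2]
    · have : kirchhoffSum G g (c • f) v = c * kirchhoffSum G g f v := by
        unfold kirchhoffSum
        rw [Finset.mul_sum]
        refine Finset.sum_congr rfl fun e _ => ?_
        rw [edgeDeriv_smul c (hf1 e) (by simp), edgeDeriv_smul c (hf1 e) (by simp)]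
        split_ifs <;> ring
      rw [this, hf4, mul_zero]

/-- `λ_k(g, ρ)`: the eigenvalues in increasing order, repeated according to multiplicity and
numbered from `0`.  It is the least `μ` such that the eigenspaces of the eigenvalues `≤ μ` span a
space of dimension at least `k + 1`. -/
def eigenvalue [Fintype E] (G : Multigraph V E) (k : ℕ) (g : E → ℝ) (ρ : EdgeFun E) : ℝ :=
  sInf {μ : ℝ | ((k + 1 : ℕ) : Cardinal) ≤
    Module.rank ℝ (⨆ ν ∈ Iic μ, eigenspace G g ρ ν : Submodule ℝ (EdgeFun E))}

/-- The total length `L(g)`. -/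
def totalLength [Fintype E] (g : E → ℝ) : ℝ := ∑ e, √(g e)

/-- The integral of `ρ` over `(G, g)` with respect to arc length. -/
def totalMass [Fintype E] (g : E → ℝ) (ρ : EdgeFun E) : ℝ :=
  ∑ e, √(g e) * ∫ x in (0 : ℝ)..1, onEdge ρ e x

/-- The naturally normalised eigenvalue with density, `λ_k(g,ρ) L(g) ∫ ρ`. -/
def normalisedEigenvalueDensity [Fintype E] (G : Multigraph V E) (k : ℕ)
    (g : E → ℝ) (ρ : EdgeFun E) : ℝ :=
  eigenvalue G k g ρ * totalLength g * totalMass g ρ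

/-- The normalised eigenvalue `λ_k(g) L(g)²`, where `λ_k(g)` is the eigenvalue of the problem
without density, that is, with density `1`. -/
def normalisedEigenvalue [Fintype E] (G : Multigraph V E) (k : ℕ) (g : E → ℝ) : ℝ :=
  eigenvalue G k g (fun _ _ => 1) * totalLength g ^ 2

/-- A metric on the graph: a positive number `g e` (the squared length) for every edge. -/
def IsMetric (g : E → ℝ) : Prop := ∀ e, 0 < g e

/-- A density: positive and smooth on every closed edge (no condition across vertices). -/
def IsDensity (ρ : EdgeFun E) : Prop :=
  (∀ e x, 0 < ρ e x) ∧ ∀ e, ContDiffOn ℝ ∞ (onEdge ρ e) (Icc 0 1)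

/-- `g(t)`, `|t| < ε`, is a smooth one-parameter family of metrics. -/
def IsSmoothMetricFamily (ε : ℝ) (g : ℝ → E → ℝ) : Prop :=
  (∀ t ∈ Ioo (-ε) ε, IsMetric (g t)) ∧
    ∀ e, ContDiffOn ℝ ∞ (fun t => g t e) (Ioo (-ε) ε)

/-- `ρ(t)`, `|t| < ε`, is a smooth one-parameter family of densities: on every closed edge,
`ρ(t)(x)` is smooth jointly in `t` and `x`. -/
def IsSmoothDensityFamily (ε : ℝ) (ρ : ℝ → EdgeFun E) : Prop :=
  (∀ t ∈ Ioo (-ε) ε, IsDensity (ρ t)) ∧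
    ∀ e, ContDiffOn ℝ ∞ (fun p : ℝ × ℝ => onEdge (ρ p.1) e p.2) (Ioo (-ε) ε ×ˢ Icc 0 1)

/-- `φ(t) ≤ ψ(t) + o(t)` as `t → 0`. -/
def LeUpToLittleO (φ ψ : ℝ → ℝ) : Prop :=
  ∃ r : ℝ → ℝ, r =o[𝓝 0] (fun t : ℝ => t) ∧ ∀ᶠ t in 𝓝 0, φ t ≤ ψ t + r t

/-- `φ(t) ≥ ψ(t) + o(t)` as `t → 0`. -/
def GeUpToLittleO (φ ψ : ℝ → ℝ) : Prop :=
  ∃ r : ℝ → ℝ, r =o[𝓝 0] (fun t : ℝ => t) ∧ ∀ᶠ t in 𝓝 0, φ t ≥ ψ t + r t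

/-- The pair `(g, ρ)` of a metric and a density is extremal for the functional `F`. -/
def IsExtremalPair (F : (E → ℝ) → EdgeFun E → ℝ) (g : E → ℝ) (ρ : EdgeFun E) : Prop :=
  IsMetric g ∧ IsDensity ρ ∧
    ∀ ε > 0, ∀ (γ : ℝ → E → ℝ) (τ : ℝ → EdgeFun E),
      IsSmoothMetricFamily ε γ → IsSmoothDensityFamily ε τ → γ 0 = g → τ 0 = ρ →
      LeUpToLittleO (fun t => F (γ t) (τ t)) (fun _ => F g ρ) ∨
        GeUpToLittleO (fun t => F (γ t) (τ t)) (fun _ => F g ρ)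

/-- The metric `g` is extremal for the functional `F`. -/
def IsExtremalMetric (F : (E → ℝ) → ℝ) (g : E → ℝ) : Prop :=
  IsMetric g ∧
    ∀ ε > 0, ∀ γ : ℝ → E → ℝ, IsSmoothMetricFamily ε γ → γ 0 = g →
      LeUpToLittleO (fun t => F (γ t)) (fun _ => F g) ∨
        GeUpToLittleO (fun t => F (γ t)) (fun _ => F g)

end QuantumGraph

end

/-! In edge coordinates the problem compares the Dirichlet form `q(u) = ∑ (1/√g_e) ∫ u'²` with the
mass form `b(u) = ∑ √g_e ∫ ρ_e u²`. Suppose a variation keeps length times mass stationary and its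
first variation `q' - λ_k b'` is positive definite on the eigenspace of `λ_k`. Then `λ_k` stays
above a line of positive slope for `t ≥ 0` and below it for `t ≤ 0` (`Spectral.lam_perturb`), so
both alternatives in the definition of extremality fail (`not_extremal_of_variation`). Two such
variations prove the theorem.

On an edge an eigenfunction satisfies `f'' = -cρf` with `c = λ_k g_e`, hence `(f²)''' + 4cρ(f²)' +
2cρ'f² = 0`. Therefore `η = ψ''' + 4cρψ' + 2cρ'ψ`, with `ψ` flat at the ends, is orthogonal to the
square of every eigenfunction (`intg_mul_sq_eq_zero`). Moving the density along `η` does not move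
the eigenvalue to first order, but for `ψ = (x(1-x))³ρ'` it changes the mass on the edge at a rate
proportional to `-∫ (x(1-x))³ρ'²`. If `ρ'` is not zero, moving along `-η` and subtracting a constant
to restore the mass gives a forbidden variation (`exists_edgewise_constant`).

Once `ρ_e = r_e` is constant, `f'² + cf²` is constant along the edge, and `∫ f'² = ∫ θf²` for a
smooth `θ` with `∫ θ = c`, now `c = λ_k g_e r_e` (`exists_energy_weight`). A change of edge lengths
can thus be compensated by a change of density. In the direction `a_e = L r_e - M`, with `L` the
length and `M` the mass, this gains `∑ √g_e (L r_e - M)²` in length times mass; the gain must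
vanish, so `r_e = M/L` (`density_constant`). Finally, for a constant density the two functionals
coincide, and families with that fixed density give extremality of the metric.

The spectral theory uses only `C¹` functions. Its core is `gap_inequality`, proved by minimising the
Rayleigh quotient with Arzelà–Ascoli; `eigenspace_eq_map` identifies the eigenspaces of the forms
with the classical ones. -/

noncomputable section

/-! ### Eigenvalues of a pair of symmetric bilinear forms -/

namespace FormPair

variable {W : Type*} [AddCommGroup W] [Module ℝ W]

/-- The eigenspace of the pair of forms `(q, b)`. -/
def Eig (q b : W →ₗ[ℝ] W →ₗ[ℝ] ℝ) (ν : ℝ) : Submodule ℝ W := LinearMap.ker (q - ν • b)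

lemma mem_Eig {q b : W →ₗ[ℝ] W →ₗ[ℝ] ℝ} {ν : ℝ} {u : W} :
    u ∈ Eig q b ν ↔ ∀ v, q u v = ν * b u v := by
  simp [Eig, LinearMap.ext_iff, sub_eq_zero]

/-- The span of the eigenspaces of the eigenvalues in `S`. -/
def EigSpan (q b : W →ₗ[ℝ] W →ₗ[ℝ] ℝ) (S : Set ℝ) : Submodule ℝ W := ⨆ ν ∈ S, Eig q b ν

lemma EigSpan_mono (q b : W →ₗ[ℝ] W →ₗ[ℝ] ℝ) {S T : Set ℝ} (h : S ⊆ T) :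
    EigSpan q b S ≤ EigSpan q b T := biSup_mono h

lemma Eig_le_EigSpan (q b : W →ₗ[ℝ] W →ₗ[ℝ] ℝ) {S : Set ℝ} {ν : ℝ} (h : ν ∈ S) :
    Eig q b ν ≤ EigSpan q b S := le_iSup₂_of_le ν h le_rfl

/-- The `k`-th eigenvalue of the pair `(q, b)`, counted from `0` with multiplicity. -/
def lam (q b : W →ₗ[ℝ] W →ₗ[ℝ] ℝ) (k : ℕ) : ℝ :=
  sInf {μ : ℝ | ((k + 1 : ℕ) : Cardinal) ≤ Module.rank ℝ (EigSpan q b (Iic μ))}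

/-- `b` is positive definite, `q` is nonnegative, and the spectrum of `q` with respect to `b`
is discrete and complete. -/
structure Spectral (q b : W →ₗ[ℝ] W →ₗ[ℝ] ℝ) : Prop where
  q_symm : ∀ u v, q u v = q v u
  b_symm : ∀ u v, b u v = b v u
  q_nonneg : ∀ u, 0 ≤ q u u
  b_pos : ∀ u, u ≠ 0 → 0 < b u u
  finite : ∀ μ, FiniteDimensional ℝ (EigSpan q b (Iic μ))
  gap : ∀ μ u, (∀ n ∈ EigSpan q b (Iio μ), b u n = 0) → μ * b u u ≤ q u u
  infinite : ¬ FiniteDimensional ℝ W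

/-- Dimension count: pairing with `b` maps `U` to the dual of `N`, whose dimension is smaller. No
definiteness or symmetry of `b` enters, which `le_lam` exploits. -/
lemma exists_ne_zero_orthogonal (b : W →ₗ[ℝ] W →ₗ[ℝ] ℝ) (U N : Submodule ℝ W)
    [FiniteDimensional ℝ N] {k : ℕ} (hN : Module.finrank ℝ N ≤ k)
    (hU : ((k + 1 : ℕ) : Cardinal) ≤ Module.rank ℝ U) :
    ∃ u ∈ U, u ≠ 0 ∧ ∀ n ∈ N, b u n = 0 := by
  by_contra! hcon
  let f : U →ₗ[ℝ] (N →ₗ[ℝ] ℝ) := (LinearMap.lcomp ℝ ℝ N.subtype) ∘ₗ b ∘ₗ U.subtype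
  have hf : Function.Injective f := by
    rw [← LinearMap.ker_eq_bot, LinearMap.ker_eq_bot']
    intro u hu
    by_contra hne
    obtain ⟨n, hn, hbn⟩ := hcon u u.2 (by simpa using hne)
    exact hbn (by simpa [f] using LinearMap.congr_fun hu ⟨n, hn⟩)
  have h1 := LinearMap.rank_le_of_injective f hf
  have h2 : Module.rank ℝ (N →ₗ[ℝ] ℝ) = (Module.finrank ℝ N : ℕ) := by
    rw [← Module.finrank_eq_rank]
    exact congrArg _ (Subspace.dual_finrank_eq (K := ℝ) (V := N))
  rw [h2] at h1
  have := hU.trans h1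
  norm_cast at this
  omega

/-- Definiteness makes the map from `N` to its dual injective, hence bijective, so no topology on
`W` is needed. -/
lemma exists_projection (b : W →ₗ[ℝ] W →ₗ[ℝ] ℝ) (hb : ∀ u, u ≠ 0 → 0 < b u u)
    (N : Submodule ℝ W) [FiniteDimensional ℝ N] (u : W) :
    ∃ v ∈ N, ∀ n ∈ N, b (u - v) n = 0 := by
  let f : N →ₗ[ℝ] (N →ₗ[ℝ] ℝ) := (LinearMap.lcomp ℝ ℝ N.subtype) ∘ₗ b ∘ₗ N.subtype
  have hf : Function.Injective f := by
    rw [← LinearMap.ker_eq_bot, LinearMap.ker_eq_bot']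
    intro v hv
    by_contra hne
    have h1 := hb v (by simpa using hne)
    have h2 := LinearMap.congr_fun hv v
    simp only [f] at h2
    exact h1.ne' (by simpa using h2)
  have hs := (LinearMap.injective_iff_surjective_of_finrank_eq_finrank
    (Subspace.dual_finrank_eq (K := ℝ) (V := N)).symm).1 hf
  obtain ⟨v, hv⟩ := hs ((b u).comp N.subtype)
  refine ⟨v, v.2, fun n hn => ?_⟩
  have := LinearMap.congr_fun hv ⟨n, hn⟩
  simp only [f, LinearMap.comp_apply, LinearMap.lcomp_apply, Submodule.subtype_apply] at this
  simp [this]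

/-! ### Min-max bounds for a pair with discrete, complete spectrum. -/

namespace Spectral

variable {q b : W →ₗ[ℝ] W →ₗ[ℝ] ℝ}

lemma b_nonneg (h : Spectral q b) (u : W) : 0 ≤ b u u := by
  by_cases hu : u = 0
  · simp [hu]
  · exact (h.b_pos u hu).le

lemma eig_orthogonal (hq : ∀ u v, q u v = q v u) (hb : ∀ u v, b u v = b v u) {ν ν' : ℝ}
    (hne : ν ≠ ν') {u v : W} (hu : u ∈ Eig q b ν) (hv : v ∈ Eig q b ν') : b u v = 0 := by
  have h1 := mem_Eig.1 hu v
  have h2 := mem_Eig.1 hv u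
  rw [hq v u, hb v u] at h2
  have : (ν - ν') * b u v = 0 := by linarith
  exact (mul_eq_zero.1 this).resolve_left (sub_ne_zero.2 hne)

lemma orthogonal_EigSpan {S : Set ℝ} {u : W} (h : ∀ ν ∈ S, ∀ n ∈ Eig q b ν, b u n = 0) {n : W}
    (hn : n ∈ EigSpan q b S) : b u n = 0 := by
  have : EigSpan q b S ≤ LinearMap.ker (b u) := iSup₂_le fun ν hν m hm => h ν hν m hm
  exact this hn

lemma eig_orthogonal_EigSpan (hq : ∀ u v, q u v = q v u) (hb : ∀ u v, b u v = b v u) {S : Set ℝ}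
    {ν : ℝ} (hν : ν ∉ S) {u n : W} (hu : u ∈ Eig q b ν) (hn : n ∈ EigSpan q b S) : b u n = 0 :=
  orthogonal_EigSpan (fun ν' hν' _ hm => eig_orthogonal hq hb (fun (h : ν = ν') => hν (h ▸ hν')) hu hm) hn

lemma q_le_of_mem_EigSpan (hq : ∀ u v, q u v = q v u) (hb : ∀ u v, b u v = b v u)
    (hb0 : ∀ u, 0 ≤ b u u) {μ : ℝ} {u : W} (hu : u ∈ EigSpan q b (Iic μ)) :
    q u u ≤ μ * b u u := by
  classical
  rw [EigSpan, iSup_subtype', Submodule.mem_iSup_iff_exists_finsupp] at hu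
  obtain ⟨f, hf, rfl⟩ := hu
  have horth : ∀ i j, i ≠ j → b (f i) (f j) = 0 := fun i j hij =>
    eig_orthogonal hq hb (fun h => hij (Subtype.ext h)) (hf i) (hf j)
  have hqf : ∀ i v, q (f i) v = i * b (f i) v := fun i => mem_Eig.1 (hf i)
  simp only [Finsupp.sum, map_sum, LinearMap.sum_apply, Finset.mul_sum]
  refine Finset.sum_le_sum fun i _ => Finset.sum_le_sum fun j _ => ?_
  rw [hqf]
  by_cases hij : i = j
  · subst hij
    exact mul_le_mul_of_nonneg_right i.2 (hb0 _)
  · simp [horth j i (Ne.symm hij)]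

lemma eig_eq_bot_of_neg (h : Spectral q b) {ν : ℝ} (hν : ν < 0) : Eig q b ν = ⊥ := by
  rw [Submodule.eq_bot_iff]
  intro u hu
  by_contra hne
  have h1 := mem_Eig.1 hu u
  have h2 := h.q_nonneg u
  nlinarith [h.b_pos u hne]

/-- Right-continuity of the spectral subspaces. -/
lemma exists_gt (h : Spectral q b) (μ : ℝ) :
    ∃ ν > μ, EigSpan q b (Iic ν) = EigSpan q b (Iic μ) := by
  let n : Ioi μ → ℕ := fun ν => Module.finrank ℝ (EigSpan q b (Iic (ν : ℝ)))
  have : Nonempty (Ioi μ) := ⟨⟨μ + 1, by simp⟩⟩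
  -- Dimensions are natural numbers, so one is least; below this `ν` and above `μ` the span is
  -- constant. An eigenvector with eigenvalue in `(μ, ν]` would be orthogonal to a span that already
  -- contains it.
  obtain ⟨ν, hν⟩ : ∃ ν, ∀ ν', n ν ≤ n ν' := ⟨Function.argmin n, fun ν' => Function.argmin_le n ν'⟩
  refine ⟨ν, ν.2, le_antisymm (iSup₂_le fun ν' hν' => ?_) (EigSpan_mono q b (Iic_subset_Iic.2 ν.2.le))⟩
  by_cases hle : ν' ≤ μ
  · exact Eig_le_EigSpan q b hle
  push Not at hle
  obtain ⟨τ, hτ1, hτ2⟩ := exists_between hle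
  have := h.finite ν
  have heq : EigSpan q b (Iic τ) = EigSpan q b (Iic (ν : ℝ)) :=
    Submodule.eq_of_le_of_finrank_le
      (EigSpan_mono q b (Iic_subset_Iic.2 (hτ2.le.trans hν'))) (hν ⟨τ, hτ1⟩)
  intro u hu
  have h0 : b u u = 0 := eig_orthogonal_EigSpan h.q_symm h.b_symm (S := Iic τ) (by simpa using hτ2)
    hu (heq ▸ Eig_le_EigSpan q b hν' hu)
  have : u = 0 := by
    by_contra hne
    exact (h.b_pos u hne).ne' h0
  simp [this]

/-- There is a gap in the spectrum below every number. -/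
lemma exists_lt (h : Spectral q b) (μ : ℝ) :
    ∃ ν < μ, EigSpan q b (Iic ν) = EigSpan q b (Iio μ) := by
  have := h.finite μ
  -- Minimising this codimension maximises the dimension; the subtraction never truncates, by `hr`.
  let n : Iio μ → ℕ := fun ν => Module.finrank ℝ (EigSpan q b (Iic μ)) -
    Module.finrank ℝ (EigSpan q b (Iic (ν : ℝ)))
  have : Nonempty (Iio μ) := ⟨⟨μ - 1, by simp⟩⟩
  obtain ⟨ν, hν⟩ : ∃ ν, ∀ ν', n ν ≤ n ν' := ⟨Function.argmin n, fun ν' => Function.argmin_le n ν'⟩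
  have hr : ∀ τ < μ, Module.finrank ℝ (EigSpan q b (Iic τ)) ≤
      Module.finrank ℝ (EigSpan q b (Iic μ)) := fun τ hτ =>
    Submodule.finrank_mono (EigSpan_mono q b (Iic_subset_Iic.2 hτ.le))
  refine ⟨ν, ν.2, le_antisymm (EigSpan_mono q b fun x (hx : x ≤ ν) => lt_of_le_of_lt hx ν.2)
    (iSup₂_le fun ν' hν' => ?_)⟩
  have hm : max (ν : ℝ) ν' < μ := max_lt ν.2 hν'
  have := h.finite (max (ν : ℝ) ν')
  have heq : EigSpan q b (Iic (ν : ℝ)) = EigSpan q b (Iic (max (ν : ℝ) ν')) := by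
    refine Submodule.eq_of_le_of_finrank_le (EigSpan_mono q b (Iic_subset_Iic.2 (le_max_left _ _))) ?_
    have h1 := hν ⟨_, hm⟩
    have h2 := hr _ hm
    have h3 := hr ν ν.2
    simp only [n] at h1
    omega
  rw [heq]
  exact Eig_le_EigSpan q b (mem_Iic.2 (le_max_right _ _))

lemma le_rank_iff (h : Spectral q b) (k : ℕ) (μ : ℝ) :
    ((k + 1 : ℕ) : Cardinal) ≤ Module.rank ℝ (EigSpan q b (Iic μ)) ↔
      k + 1 ≤ Module.finrank ℝ (EigSpan q b (Iic μ)) := by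
  have := h.finite μ
  rw [← Module.finrank_eq_rank]
  norm_cast

/-- If all dimensions were at most `k`, the spans would stabilise. A nonzero vector orthogonal to
the final span would then satisfy `μ * b u u ≤ q u u` for all large `μ`. -/
lemma nonempty (h : Spectral q b) (k : ℕ) :
    {μ : ℝ | ((k + 1 : ℕ) : Cardinal) ≤ Module.rank ℝ (EigSpan q b (Iic μ))}.Nonempty := by
  by_contra hcon
  rw [Set.not_nonempty_iff_eq_empty] at hcon
  have hk : ∀ μ, Module.finrank ℝ (EigSpan q b (Iic μ)) ≤ k := fun μ => by
    by_contra hlt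
    have : μ ∈ (∅ : Set ℝ) := hcon ▸ (h.le_rank_iff k μ).2 (by omega)
    exact this
  let n : ℝ → ℕ := fun μ => k - Module.finrank ℝ (EigSpan q b (Iic μ))
  obtain ⟨ν, hν⟩ : ∃ ν, ∀ ν', n ν ≤ n ν' := ⟨Function.argmin n, fun ν' => Function.argmin_le n ν'⟩
  have heq : ∀ μ, ν ≤ μ → EigSpan q b (Iic ν) = EigSpan q b (Iic μ) := fun μ hμ => by
    have := h.finite μ
    refine Submodule.eq_of_le_of_finrank_le (EigSpan_mono q b (Iic_subset_Iic.2 hμ)) ?_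
    have h1 := hν μ
    have h2 := hk μ
    have h3 := hk ν
    simp only [n] at h1
    omega
  have := h.finite ν
  have hinf : ((k + 1 : ℕ) : Cardinal) ≤ Module.rank ℝ (⊤ : Submodule ℝ W) := by
    rw [rank_top]
    by_contra hlt
    exact h.infinite (Module.rank_lt_aleph0_iff.1 ((not_le.1 hlt).trans (Cardinal.natCast_lt_aleph0)))
  obtain ⟨u, -, hu0, hu⟩ := exists_ne_zero_orthogonal b ⊤ _ (hk ν) hinf
  have hb := h.b_pos u hu0
  have key : ∀ μ, ν ≤ μ → μ * b u u ≤ q u u := fun μ hμ => h.gap μ u fun n hn =>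
    hu n (by rw [heq μ hμ]; exact EigSpan_mono q b Iio_subset_Iic_self hn)
  have := key (max ν (q u u / b u u + 1)) (le_max_left _ _)
  have h2 : (q u u / b u u + 1) * b u u ≤ max ν (q u u / b u u + 1) * b u u :=
    mul_le_mul_of_nonneg_right (le_max_right _ _) hb.le
  rw [add_mul, div_mul_cancel₀ _ hb.ne'] at h2
  linarith

lemma bddBelow (h : Spectral q b) (k : ℕ) :
    BddBelow {μ : ℝ | ((k + 1 : ℕ) : Cardinal) ≤ Module.rank ℝ (EigSpan q b (Iic μ))} := by
  refine ⟨0, fun μ hμ => ?_⟩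
  by_contra hlt
  have : EigSpan q b (Iic μ) = ⊥ := by
    rw [eq_bot_iff]
    exact iSup₂_le fun ν hν => (h.eig_eq_bot_of_neg (lt_of_le_of_lt hν (not_le.1 hlt))).le
  have h1 := (h.le_rank_iff k μ).1 hμ
  rw [this, finrank_bot] at h1
  omega

lemma le_finrank_lam (h : Spectral q b) (k : ℕ) :
    k + 1 ≤ Module.finrank ℝ (EigSpan q b (Iic (lam q b k))) := by
  obtain ⟨ν, hν, heq⟩ := h.exists_gt (lam q b k)
  obtain ⟨μ, hμ, hμν⟩ := exists_lt_of_csInf_lt (h.nonempty k) hν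
  have := h.finite ν
  rw [← heq]
  exact ((h.le_rank_iff k μ).1 hμ).trans
    (Submodule.finrank_mono (EigSpan_mono q b (Iic_subset_Iic.2 hμν.le)))

lemma finite_Iio (h : Spectral q b) (μ : ℝ) : FiniteDimensional ℝ (EigSpan q b (Iio μ)) :=
  have := h.finite μ
  Submodule.finiteDimensional_of_le (EigSpan_mono q b Iio_subset_Iic_self)

lemma finrank_lt_lam (h : Spectral q b) (k : ℕ) :
    Module.finrank ℝ (EigSpan q b (Iio (lam q b k))) ≤ k := by
  obtain ⟨ν, hν, heq⟩ := h.exists_lt (lam q b k)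
  rw [← heq]
  by_contra hlt
  exact notMem_of_lt_csInf hν (h.bddBelow k) ((h.le_rank_iff k ν).2 (by omega))

lemma lam_le (h : Spectral q b) {k : ℕ} {μ : ℝ} (U : Submodule ℝ W)
    (hU : ((k + 1 : ℕ) : Cardinal) ≤ Module.rank ℝ U) (hq : ∀ u ∈ U, q u u ≤ μ * b u u) :
    lam q b k ≤ μ := by
  by_contra! hlt
  have := h.finite_Iio (lam q b k)
  obtain ⟨u, hu, hu0, horth⟩ := exists_ne_zero_orthogonal b U _ (h.finrank_lt_lam k) hU
  have h1 := h.gap _ u horth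
  have h2 := hq u hu
  nlinarith [h.b_pos u hu0]

/-- The constraint may be orthogonality for any form `b'`. The perturbation argument takes the
unperturbed mass form, so that the test space does not depend on `t`. -/
lemma le_lam (h : Spectral q b) {k : ℕ} {μ : ℝ} (b' : W →ₗ[ℝ] W →ₗ[ℝ] ℝ) (N : Submodule ℝ W)
    [FiniteDimensional ℝ N] (hN : Module.finrank ℝ N ≤ k)
    (hq : ∀ u, (∀ n ∈ N, b' u n = 0) → μ * b u u ≤ q u u) : μ ≤ lam q b k := by
  by_contra! hlt
  obtain ⟨u, hu, hu0, horth⟩ := exists_ne_zero_orthogonal b' _ N hN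
    ((h.le_rank_iff k _).2 (h.le_finrank_lam k))
  have h1 := hq u horth
  have h2 := q_le_of_mem_EigSpan h.q_symm h.b_symm h.b_nonneg hu
  nlinarith [h.b_pos u hu0]

lemma lam_pos (h : Spectral q b) {k : ℕ} (hk : 1 ≤ k)
    (h0 : Module.finrank ℝ (Eig q b 0) ≤ 1) : 0 < lam q b k := by
  by_contra! hle
  have hsub : EigSpan q b (Iic (lam q b k)) ≤ Eig q b 0 := by
    refine iSup₂_le fun ν hν => ?_
    rcases (le_trans hν hle : ν ≤ 0).lt_or_eq with h1 | h1
    · rw [h.eig_eq_bot_of_neg h1]; exact bot_le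
    · rw [h1]
  have := h.finite 0
  have : FiniteDimensional ℝ (Eig q b 0) :=
    Submodule.finiteDimensional_of_le (Eig_le_EigSpan q b (self_mem_Iic (a := (0 : ℝ))))
  have := Submodule.finrank_mono hsub
  have := h.le_finrank_lam k
  omega

end Spectral
end FormPair

/-! ### First-order perturbation of an eigenvalue of a pair of forms. -/

namespace FormPair

variable {W : Type*} [AddCommGroup W] [Module ℝ W]

/-- Polarisation: apply the bound to `ε • v + w` and `ε • v - w` and subtract. -/
lemma cross_bound {B N : W →ₗ[ℝ] W →ₗ[ℝ] ℝ} (hB : ∀ u v, B u v = B v u)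
    (hN : ∀ u v, N u v = N v u) {C : ℝ} (hBN : ∀ u, |B u u| ≤ C * N u u) {ε : ℝ} (hε : 0 < ε)
    (v w : W) : -(C * (ε * N v v + N w w / ε)) ≤ 2 * B v w := by
  have h1 := (abs_le.1 (hBN (ε • v + w))).1
  have h2 := (abs_le.1 (hBN (ε • v - w))).2
  simp only [map_add, map_sub, map_smul, LinearMap.add_apply, LinearMap.sub_apply,
    LinearMap.smul_apply, smul_eq_mul, hB w v, hN w v] at h1 h2
  have h3 : 0 ≤ ε * (2 * B v w + C * (ε * N v v + N w w / ε)) := by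
    have : ε * (2 * B v w + C * (ε * N v v + N w w / ε)) =
      2 * ε * B v w + C * (ε ^ 2 * N v v + N w w) := by field_simp
    rw [this]
    nlinarith
  have := nonneg_of_mul_nonneg_right h3 hε
  linarith

/-- On the kernel direction `v` positivity comes from `t • B`; on `w` it comes from the gap `δ` of
`A`, which absorbs for small `t` everything `B` can lose there, including the cross terms. -/
lemma perturbed_form_bound {A B N : W →ₗ[ℝ] W →ₗ[ℝ] ℝ} (hA : ∀ u v, A u v = A v u)
    (hB : ∀ u v, B u v = B v u) (hN : ∀ u v, N u v = N v u) (hN0 : ∀ u, 0 ≤ N u u)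
    {C c δ t : ℝ} (hC : 0 < C) (hc : 0 < c) (hBN : ∀ u, |B u u| ≤ C * N u u) (ht : 0 ≤ t)
    (htδ : t * (2 * C ^ 2 / c + C + c / 2) ≤ δ) {v w : W} (hAv : ∀ x, A v x = 0)
    (hAw : δ * N w w ≤ A w w) (hBv : c * N v v ≤ B v v) :
    t * (c / 4) * N (v + w) (v + w) ≤ A (v + w) (v + w) + t * B (v + w) (v + w) := by
  -- With this `ε` the cross term costs `c / 2 * N v v`, half of what `hBv` provides.
  have h1 := cross_bound hB hN hBN (ε := c / (2 * C)) (by positivity) v w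
  have h1' : C * (c / (2 * C) * N v v + N w w / (c / (2 * C))) =
      c / 2 * N v v + 2 * C ^ 2 / c * N w w := by field_simp
  rw [h1'] at h1
  have h2 := (abs_le.1 (hBN w)).1
  have h3 : N (v + w) (v + w) ≤ 2 * (N v v + N w w) := by
    have := hN0 (v - w)
    simp only [map_add, map_sub, LinearMap.add_apply, LinearMap.sub_apply, hN w v] at this ⊢
    linarith
  have h4 : c / 2 * N v v - (2 * C ^ 2 / c + C) * N w w ≤ B (v + w) (v + w) := by
    simp only [map_add, LinearMap.add_apply, hB w v]
    linarith
  have h5 : A (v + w) (v + w) = A w w := by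
    simp [hAv, hA w v]
  rw [h5]
  have h6 := mul_le_mul_of_nonneg_left h4 ht
  have h7 := mul_le_mul_of_nonneg_left h3 (by positivity : 0 ≤ t * (c / 4))
  have h8 := mul_le_mul_of_nonneg_right htδ (hN0 w)
  linarith

variable {q b q' b' : W →ₗ[ℝ] W →ₗ[ℝ] ℝ}

/-- If the first variation of `q - λ b` is positive definite on the eigenspace of `λ`, then every
eigenvalue of the affine family equal to `λ` at `t = 0` increases at a positive rate. -/
theorem Spectral.lam_perturb (hS : ∀ᶠ t : ℝ in 𝓝 0, Spectral (q + t • q') (b + t • b'))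
    (hq' : ∀ u v, q' u v = q' v u) (hb' : ∀ u v, b' u v = b' v u) {C : ℝ}
    (hCq : ∀ u, |q' u u| ≤ C * (q u u + b u u)) (hCb : ∀ u, |b' u u| ≤ C * (q u u + b u u))
    (k : ℕ) {c : ℝ} (hc : 0 < c)
    (hB : ∀ v ∈ Eig q b (lam q b k),
      c * (q v v + b v v) ≤ q' v v - lam q b k * b' v v) :
    ∃ c > 0, ∀ᶠ t : ℝ in 𝓝 0,
      (0 ≤ t → lam q b k + c * t ≤ lam (q + t • q') (b + t • b') k) ∧
      (t ≤ 0 → lam (q + t • q') (b + t • b') k ≤ lam q b k + c * t) := by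
  have h : Spectral q b := by simpa using hS.self_of_nhds
  set l := lam q b k with hl
  set N := q + b with hNdef
  set A := q - l • b with hAdef
  set B := q' - l • b' with hBdef
  have hNa : ∀ u v, N u v = q u v + b u v := fun u v => rfl
  have hAa : ∀ u v, A u v = q u v - l * b u v := fun u v => rfl
  have hBa : ∀ u v, B u v = q' u v - l * b' u v := fun u v => rfl
  have hNs : ∀ u v, N u v = N v u := fun u v => by rw [hNa, hNa, h.q_symm, h.b_symm]
  have hAs : ∀ u v, A u v = A v u := fun u v => by rw [hAa, hAa, h.q_symm, h.b_symm]
  have hBs : ∀ u v, B u v = B v u := fun u v => by rw [hBa, hBa, hq', hb']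
  have hN0 : ∀ u, 0 ≤ N u u := fun u => add_nonneg (h.q_nonneg u) (h.b_nonneg u)
  set D := |C| * (1 + |l|) + 1 with hD
  have hD0 : 0 < D := by positivity
  have hBN : ∀ u, |B u u| ≤ D * N u u := fun u => by
    have h1 := hCq u
    have h2 := hCb u
    have h3 : C * (q u u + b u u) ≤ |C| * N u u :=
      mul_le_mul_of_nonneg_right (le_abs_self C) (hN0 u)
    calc |B u u| ≤ |q' u u| + |l * b' u u| := by rw [hBa]; exact abs_sub _ _
      _ = |q' u u| + |l| * |b' u u| := by rw [abs_mul]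
      _ ≤ |C| * N u u + |l| * (|C| * N u u) :=
        add_le_add (h1.trans h3) (mul_le_mul_of_nonneg_left (h2.trans h3) (abs_nonneg l))
      _ ≤ D * N u u := by rw [hD]; linarith [hN0 u]
  obtain ⟨ν, hν, hνeq⟩ := h.exists_gt l
  obtain ⟨τ, hτ, hτeq⟩ := h.exists_lt l
  obtain ⟨δ, hδ, hδ1⟩ : ∃ δ > 0, ∀ w, (∀ n ∈ EigSpan q b (Iic l), b w n = 0) →
      δ * N w w ≤ A w w := by
    have h1 : 0 < 1 + |l| := by positivity
    have hd : 0 < (ν - l) / (1 + |ν|) := by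
      have : 0 < ν - l := sub_pos.2 hν
      positivity
    -- The gap `ν - l` by itself controls only `b`; capping by `1` and halving leaves a share of `q
    -- w w`, so that all of `N` is controlled.
    refine ⟨min 1 ((ν - l) / (1 + |ν|)) / 2, by positivity, fun w hw => ?_⟩
    have hq := h.gap ν w fun n hn => hw n (hνeq ▸ EigSpan_mono q b Iio_subset_Iic_self hn)
    set d := min 1 ((ν - l) / (1 + |ν|)) with hdd
    have hd0 : 0 < d := by positivity
    have hd1 : d ≤ 1 := min_le_left _ _
    have hd2 : d * (1 + |ν|) ≤ ν - l := by
      have := min_le_right 1 ((ν - l) / (1 + |ν|))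
      rwa [← hdd, le_div_iff₀ (by positivity)] at this
    rw [hNa, hAa]
    have hb := h.b_nonneg w
    have h4 := mul_le_mul_of_nonneg_right hd2 hb
    have h5 : 0 ≤ (1 - d / 2) * (q w w - ν * b w w) :=
      mul_nonneg (by linarith) (by linarith)
    have h6 : d * ν * b w w ≤ d * |ν| * b w w :=
      mul_le_mul_of_nonneg_right (mul_le_mul_of_nonneg_left (le_abs_self ν) hd0.le) hb
    have h7 : 0 ≤ d * |ν| * b w w := by positivity
    nlinarith [mul_nonneg hd0.le hb]
  obtain ⟨δ', hδ', hδ2⟩ : ∃ δ > 0, ∀ w ∈ EigSpan q b (Iio l), δ * N w w ≤ -A w w := by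
    have hd : 0 < (l - τ) / (1 + |τ|) := by
      have : 0 < l - τ := sub_pos.2 hτ
      positivity
    refine ⟨_, hd, fun w hw => ?_⟩
    rw [← hτeq] at hw
    have hq := q_le_of_mem_EigSpan h.q_symm h.b_symm h.b_nonneg hw
    have hb := h.b_nonneg w
    rw [hNa, hAa]
    have h1 : q w w + b w w ≤ (1 + |τ|) * b w w := by
      have := mul_le_mul_of_nonneg_right (le_abs_self τ) hb
      linarith
    calc (l - τ) / (1 + |τ|) * (q w w + b w w)
        ≤ (l - τ) / (1 + |τ|) * ((1 + |τ|) * b w w) := mul_le_mul_of_nonneg_left h1 hd.le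
      _ = (l - τ) * b w w := by field_simp
      _ ≤ _ := by linarith
  set K := 2 * D ^ 2 / c + D + c / 2 with hK
  have hK0 : 0 < K := by positivity
  have hsmall : ∀ᶠ t : ℝ in 𝓝 0, |t| < min (min (δ / K) (δ' / K)) (1 / (|C| + 1)) := by
    have h0 : 0 < min (min (δ / K) (δ' / K)) (1 / (|C| + 1)) := by positivity
    filter_upwards [Metric.ball_mem_nhds (0 : ℝ) h0] with t ht
    simpa using ht
  have hfin : FiniteDimensional ℝ (EigSpan q b (Iio l)) := h.finite_Iio l
  have hfin2 : FiniteDimensional ℝ (EigSpan q b (Iic l)) := h.finite l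
  have hfin3 : FiniteDimensional ℝ (Eig q b l) :=
    Submodule.finiteDimensional_of_le (Eig_le_EigSpan q b self_mem_Iic)
  have hCb' : ∀ u, |b' u u| ≤ |C| * N u u := fun u => (hCb u).trans
    (mul_le_mul_of_nonneg_right (le_abs_self C) (hN0 u))
  have hbN : ∀ u, b u u ≤ N u u := fun u => by rw [hNa]; linarith [h.q_nonneg u]
  -- Of the rate `c / 4` on `N`, one half pays for the shift of the eigenvalue against `b`, the
  -- other for the second-order term `t ^ 2 * b'` (see `hrem`).
  refine ⟨c / 8, by positivity, ?_⟩
  filter_upwards [hS, hsmall] with t hSt ht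
  rw [lt_min_iff, lt_min_iff] at ht
  obtain ⟨⟨ht1, ht2⟩, ht3⟩ := ht
  rw [lt_div_iff₀ hK0] at ht1 ht2
  rw [lt_div_iff₀ (by positivity)] at ht3
  have hrem : ∀ u, |t| * (c / 8) * b u u + (c / 8) * t ^ 2 * |b' u u| ≤
      |t| * (c / 4) * N u u := fun u => by
    have h1 : |t| * (|t| * |b' u u|) ≤ |t| * N u u := by
      refine mul_le_mul_of_nonneg_left ?_ (abs_nonneg t)
      calc |t| * |b' u u| ≤ |t| * (|C| * N u u) :=
            mul_le_mul_of_nonneg_left (hCb' u) (abs_nonneg t)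
        _ = (|t| * |C|) * N u u := by ring
        _ ≤ 1 * N u u := mul_le_mul_of_nonneg_right (by nlinarith [abs_nonneg t]) (hN0 u)
        _ = N u u := one_mul _
    have h2 := mul_le_mul_of_nonneg_left (hbN u) (abs_nonneg t)
    have h3 : t ^ 2 = |t| * |t| := by rw [← sq_abs, sq]
    rw [h3]
    nlinarith
  constructor
  · intro ht0
    rw [abs_of_nonneg ht0] at *
    -- A vector orthogonal to the eigenspaces strictly below `l` is an eigenvector for `l` plus a
    -- vector on which `A` has a positive gap.
    refine hSt.le_lam b (EigSpan q b (Iio l)) (h.finrank_lt_lam k) fun u hu => ?_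
    obtain ⟨v, hv, hvu⟩ := exists_projection b h.b_pos (Eig q b l) u
    have hw : ∀ n ∈ EigSpan q b (Iic l), b (u - v) n = 0 := fun n hn => by
      refine orthogonal_EigSpan (fun μ hμ m hm => ?_) hn
      rcases (show μ ≤ l from hμ).lt_or_eq with h1 | h1
      · rw [map_sub, LinearMap.sub_apply, hu m (Eig_le_EigSpan q b (mem_Iio.2 h1) hm),
          eig_orthogonal h.q_symm h.b_symm h1.ne' hv hm, sub_zero]
      · exact hvu m (h1 ▸ hm)
    have hkey := perturbed_form_bound (v := v) (w := u - v) hAs hBs hNs hN0 hD0 hc hBN ht0 ht1.le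
      (fun x => by rw [hAa, mem_Eig.1 hv, sub_self]) (hδ1 _ hw) (hB v hv)
    rw [add_sub_cancel] at hkey
    have h1 := hrem u
    have h2 := neg_abs_le (b' u u)
    have h2' := le_abs_self (b' u u)
    rw [hAa, hBa] at hkey
    simp only [LinearMap.add_apply, LinearMap.smul_apply, smul_eq_mul]
    have h3 : c / 8 * t ^ 2 * b' u u ≤ c / 8 * t ^ 2 * |b' u u| :=
      mul_le_mul_of_nonneg_left h2' (by positivity)
    linarith
  · intro ht0
    rw [abs_of_nonpos ht0] at *
    -- Mirror case: the test space is spanned by the eigenspaces up to `l`, and the bound is applied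
    -- to `-A` and `-t`, since `-A` has a positive gap on the eigenspaces strictly below `l`.
    refine hSt.lam_le (EigSpan q b (Iic l)) ((h.le_rank_iff k l).2 (h.le_finrank_lam k))
      fun u hu => ?_
    have hsup : EigSpan q b (Iic l) ≤ Eig q b l ⊔ EigSpan q b (Iio l) := by
      refine iSup₂_le fun μ hμ => ?_
      rcases (show μ ≤ l from hμ).lt_or_eq with h1 | h1
      · exact le_sup_of_le_right (Eig_le_EigSpan q b (mem_Iio.2 h1))
      · exact le_sup_of_le_left (h1 ▸ le_rfl)
    obtain ⟨v, hv, w, hw, rfl⟩ := Submodule.mem_sup.1 (hsup hu)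
    have hkey := perturbed_form_bound (A := -A) (v := v) (w := w)
      (fun u v => by simp [hAs u v]) hBs hNs hN0 hD0 hc hBN (neg_nonneg.2 ht0) ht2.le
      (fun x => by rw [LinearMap.neg_apply, LinearMap.neg_apply, hAa, mem_Eig.1 hv, sub_self, neg_zero])
      (hδ2 _ hw) (hB v hv)
    generalize v + w = u at *
    have h1 := hrem u
    have h2 := neg_abs_le (b' u u)
    rw [LinearMap.neg_apply, LinearMap.neg_apply, hAa, hBa] at hkey
    simp only [LinearMap.add_apply, LinearMap.smul_apply, smul_eq_mul]
    have h3 : c / 8 * t ^ 2 * -|b' u u| ≤ c / 8 * t ^ 2 * b' u u :=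
      mul_le_mul_of_nonneg_left h2 (by positivity)
    linarith

end FormPair

/-! ### Calculus on the unit interval -/

namespace UnitCalc

/-- The constant extension of a function on `[0,1]` to the real line. -/
def ext (f : C(I, ℝ)) : ℝ → ℝ := IccExtend zero_le_one f

lemma ext_coe (f : C(I, ℝ)) (x : I) : ext f x = f x := IccExtend_val _ _ x

lemma ext_of_mem (f : C(I, ℝ)) {x : ℝ} (hx : x ∈ Icc (0 : ℝ) 1) : ext f x = f ⟨x, hx⟩ :=
  IccExtend_of_mem _ _ hx

lemma continuous_ext (f : C(I, ℝ)) : Continuous (ext f) := f.continuous.Icc_extend'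

/-- Integration over `[0,1]`. -/
def intg : C(I, ℝ) →ₗ[ℝ] ℝ where
  toFun f := ∫ x in (0 : ℝ)..1, ext f x
  map_add' f g := by
    rw [← intervalIntegral.integral_add ((continuous_ext f).intervalIntegrable _ _)
      ((continuous_ext g).intervalIntegrable _ _)]
    rfl
  map_smul' c f := by
    simp only [RingHom.id_apply, smul_eq_mul]
    rw [← intervalIntegral.integral_const_mul]
    rfl

lemma intg_mono {f g : C(I, ℝ)} (h : ∀ x, f x ≤ g x) : intg f ≤ intg g :=
  intervalIntegral.integral_mono_on zero_le_one ((continuous_ext f).intervalIntegrable _ _)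
    ((continuous_ext g).intervalIntegrable _ _) fun x hx => by
      rw [ext_of_mem f hx, ext_of_mem g hx]; exact h _

lemma intg_const (c : ℝ) : intg (ContinuousMap.const I c) = c := by
  have : ext (ContinuousMap.const I c) = fun _ => c := rfl
  simp [intg, this]

lemma intg_nonneg {f : C(I, ℝ)} (h : ∀ x, 0 ≤ f x) : 0 ≤ intg f := by
  have := intg_mono (f := 0) h
  rwa [map_zero] at this

lemma eq_zero_of_intg_eq_zero {f : C(I, ℝ)} (h : ∀ x, 0 ≤ f x) (h0 : intg f = 0) : f = 0 := by
  have h1 : ∀ x ∈ Icc (0 : ℝ) 1, ext f x = 0 := by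
    by_contra! hcon
    obtain ⟨x, hx, hne⟩ := hcon
    have hpos : 0 < ext f x := lt_of_le_of_ne (by rw [ext_of_mem f hx]; exact h _) hne.symm
    have := intervalIntegral.integral_pos zero_lt_one (continuous_ext f).continuousOn
      (fun y hy => by rw [ext_of_mem f (Ioc_subset_Icc_self hy)]; exact h _) ⟨x, hx, hpos⟩
    exact this.ne' h0
  ext x
  rw [← ext_coe]
  exact h1 x x.2

lemma intg_pos {f : C(I, ℝ)} (h : ∀ x, 0 ≤ f x) (hf : f ≠ 0) : 0 < intg f :=
  lt_of_le_of_ne (intg_nonneg h) fun h0 => hf (eq_zero_of_intg_eq_zero h h0.symm)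

lemma abs_intg_le (f : C(I, ℝ)) : |intg f| ≤ ‖f‖ := by
  have h : ∀ x, |f x| ≤ ‖f‖ := fun x => f.norm_coe_le_norm x
  refine abs_le.2 ⟨?_, ?_⟩
  · rw [← intg_const (-‖f‖)]
    exact intg_mono fun x => (abs_le.1 (h x)).1
  · rw [← intg_const ‖f‖]
    exact intg_mono fun x => (abs_le.1 (h x)).2

lemma continuous_intg : Continuous intg :=
  (LinearMap.mkContinuous intg 1 fun f => by rw [one_mul]; exact abs_intg_le f).continuous

/-- `f'` is the derivative of `f` on `[0,1]`, one-sided at the endpoints. -/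
def IsDer (f f' : C(I, ℝ)) : Prop :=
  ∀ x : I, HasDerivWithinAt (ext f) (f' x) (Icc 0 1) x

namespace IsDer

variable {f g f' g' : C(I, ℝ)}

lemma add (hf : IsDer f f') (hg : IsDer g g') : IsDer (f + g) (f' + g') :=
  fun x => (hf x).add (hg x)

lemma sub (hf : IsDer f f') (hg : IsDer g g') : IsDer (f - g) (f' - g') :=
  fun x => (hf x).sub (hg x)

lemma smul (c : ℝ) (hf : IsDer f f') : IsDer (c • f) (c • f') := fun x => (hf x).const_smul c

lemma mul (hf : IsDer f f') (hg : IsDer g g') : IsDer (f * g) (f' * g + f * g') := fun x => by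
  have h := (hf x).mul (hg x)
  rw [ext_coe, ext_coe] at h
  exact h

lemma const (c : ℝ) : IsDer (ContinuousMap.const I c) 0 := fun _ =>
  hasDerivWithinAt_const _ _ c

lemma congr (hf : IsDer f f') (h : f' = g') : IsDer f g' := h ▸ hf

lemma unique (hf : IsDer f f') (hf2 : IsDer f g') : f' = g' := by
  ext x
  exact (uniqueDiffOn_Icc zero_lt_one x x.2).eq_deriv _ (hf x) (hf2 x)

lemma hasDerivAt (hf : IsDer f f') {x : ℝ} (hx : x ∈ Ioo (0 : ℝ) 1) :
    HasDerivAt (ext f) (ext f' x) x := by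
  rw [ext_of_mem f' (Ioo_subset_Icc_self hx)]
  exact (hf ⟨x, Ioo_subset_Icc_self hx⟩).hasDerivAt (Icc_mem_nhds hx.1 hx.2)

lemma integral_eq (hf : IsDer f f') {x y : ℝ} (hx : 0 ≤ x) (hxy : x ≤ y) (hy : y ≤ 1) :
    ∫ s in x..y, ext f' s = ext f y - ext f x :=
  intervalIntegral.integral_eq_sub_of_hasDerivAt_of_le hxy (continuous_ext f).continuousOn
    (fun _ hs => hf.hasDerivAt ⟨hx.trans_lt hs.1, hs.2.trans_le hy⟩)
    ((continuous_ext f').intervalIntegrable _ _)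

lemma intg_eq (hf : IsDer f f') : intg f' = f 1 - f 0 := by
  have := hf.integral_eq le_rfl zero_le_one le_rfl
  have h1 := ext_coe f 1
  have h0 := ext_coe f 0
  simp only [Icc.coe_one, Icc.coe_zero] at h1 h0
  rw [← h1, ← h0]
  exact this

/-- Cauchy–Schwarz, obtained from the nonnegativity of `∫ (f' - θ)²` for the mean slope `θ`. -/
lemma hoelder_of_le (hf : IsDer f f') {x y : I} (hxy : x ≤ y) :
    (f y - f x) ^ 2 ≤ ((y : ℝ) - x) * intg (f' ^ 2) := by
  have hxy' : (x : ℝ) ≤ y := hxy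
  have hd := hf.integral_eq x.2.1 hxy' y.2.2
  rw [ext_coe, ext_coe] at hd
  have hle : ∫ s in (x : ℝ)..y, ext f' s ^ 2 ≤ intg (f' ^ 2) :=
    intervalIntegral.integral_mono_interval x.2.1 hxy' y.2.2
      (Eventually.of_forall fun s => sq_nonneg (ext f' s))
      (((continuous_ext f').pow 2).intervalIntegrable _ _)
  set T := intg (f' ^ 2)
  rcases hxy'.eq_or_lt with h | h
  · have : x = y := Subtype.ext h
    simp [this]
  have hL : 0 < (y : ℝ) - x := sub_pos.2 h
  have hint : IntervalIntegrable (ext f') MeasureTheory.volume x y :=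
    (continuous_ext f').intervalIntegrable _ _
  have hint2 : IntervalIntegrable (fun s => ext f' s ^ 2) MeasureTheory.volume x y :=
    ((continuous_ext f').pow 2).intervalIntegrable _ _
  set θ := (f y - f x) / (y - x) with hθ
  have h1 : 0 ≤ ∫ s in (x : ℝ)..y, (ext f' s - θ) ^ 2 :=
    intervalIntegral.integral_nonneg hxy' fun s _ => sq_nonneg _
  have h2 : ∫ s in (x : ℝ)..y, (ext f' s - θ) ^ 2 =
      (∫ s in (x : ℝ)..y, ext f' s ^ 2) - 2 * θ * (f y - f x) + (y - x) * θ ^ 2 := by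
    rw [← hd]
    have : (fun s => (ext f' s - θ) ^ 2) = fun s => ext f' s ^ 2 - 2 * θ * ext f' s + θ ^ 2 := by
      ext s; ring
    rw [this, intervalIntegral.integral_add (hint2.sub (hint.const_mul _)) (by simp),
      intervalIntegral.integral_sub hint2 (hint.const_mul _),
      intervalIntegral.integral_const_mul, intervalIntegral.integral_const, smul_eq_mul]
  have h3 : f y - f x = θ * (y - x) := by rw [hθ]; field_simp
  rw [h2, h3] at h1
  rw [h3]
  nlinarith

lemma hoelder (hf : IsDer f f') (x y : I) :
    (f x - f y) ^ 2 ≤ |(x : ℝ) - y| * intg (f' ^ 2) := by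
  rcases le_total x y with h | h
  · have h' : (x : ℝ) ≤ y := h
    rw [abs_sub_comm, abs_of_nonneg (sub_nonneg.2 h'), ← neg_sub, neg_sq]
    exact hf.hoelder_of_le h
  · have h' : (y : ℝ) ≤ x := h
    rw [abs_of_nonneg (sub_nonneg.2 h')]
    exact hf.hoelder_of_le h

lemma eq_of_deriv_zero (hf : IsDer f 0) (x y : I) : f x = f y := by
  have := hf.hoelder x y
  rw [zero_pow two_ne_zero, map_zero, mul_zero] at this
  exact sub_eq_zero.1 (pow_eq_zero_iff two_ne_zero |>.1 (le_antisymm this (sq_nonneg _)))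

/-- Integrate `f x ^ 2 ≤ 2 * f y ^ 2 + 2 * (f x - f y) ^ 2` over `y`. -/
lemma sq_le (hf : IsDer f f') (x : I) :
    f x ^ 2 ≤ 2 * intg (f ^ 2) + 2 * intg (f' ^ 2) := by
  have h : ∀ y, (ContinuousMap.const I (f x ^ 2 - 2 * intg (f' ^ 2))) y ≤
      ((2 : ℝ) • f ^ 2) y := fun y => by
    have h1 := hf.hoelder x y
    have h2 : |(x : ℝ) - y| ≤ 1 :=
      abs_le.2 ⟨by linarith [x.2.1, y.2.2], by linarith [x.2.2, y.2.1]⟩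
    have h3 : 0 ≤ intg (f' ^ 2) := intg_nonneg fun z => sq_nonneg (f' z)
    have h4 : f x ^ 2 - 2 * intg (f' ^ 2) ≤ 2 * f y ^ 2 := by
      nlinarith [sq_nonneg (f x - 2 * f y)]
    simpa using h4
  have := intg_mono h
  rw [intg_const, map_smul, smul_eq_mul] at this
  linarith

end IsDer

lemma exists_primitive (f' : C(I, ℝ)) : ∃ f : C(I, ℝ), IsDer f f' ∧ f 0 = 0 := by
  let F : ℝ → ℝ := fun x => ∫ s in (0 : ℝ)..x, ext f' s
  have hF : ∀ x, HasDerivAt F (ext f' x) x := fun x =>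
    intervalIntegral.integral_hasDerivAt_right ((continuous_ext f').intervalIntegrable _ _)
      ((continuous_ext f').stronglyMeasurableAtFilter _ _) (continuous_ext f').continuousAt
  have hc : Continuous F := continuous_iff_continuousAt.2 fun x => (hF x).continuousAt
  refine ⟨⟨fun x => F x, hc.comp continuous_subtype_val⟩, fun x => ?_, by simp [F]⟩
  rw [← ext_coe]
  refine ((hF x).hasDerivWithinAt (s := Icc 0 1)).congr (fun y hy => ?_) ?_
  · rw [ext_of_mem _ hy]; rfl
  · rw [ext_coe]; rfl

/-- The coordinate function on `[0,1]`. -/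
def coord : C(I, ℝ) := ⟨fun x => x, continuous_subtype_val⟩

@[simp] lemma coord_apply (x : I) : coord x = x := rfl

lemma isDer_coord : IsDer coord 1 := fun x =>
  (hasDerivWithinAt_id (x : ℝ) (Icc 0 1)).congr (fun y hy => by rw [ext_of_mem _ hy]; rfl)
    (by rw [ext_coe]; rfl)

/-- A bounded family of functions on `[0,1]` with a uniform `1/2`-Hölder bound is compact. -/
lemma isCompact_hoelder (C : ℝ) :
    IsCompact {f : C(I, ℝ) | (∀ x, |f x| ≤ C) ∧
      ∀ x y, (f x - f y) ^ 2 ≤ |(x : ℝ) - y| * C} := by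
  set A : Set C(I, ℝ) := {f : C(I, ℝ) | (∀ x, |f x| ≤ C) ∧
      ∀ x y, (f x - f y) ^ 2 ≤ |(x : ℝ) - y| * C} with hA
  have hcl : IsClosed A := by
    have h1 : ∀ x : I, Continuous fun f : C(I, ℝ) => f x := fun x =>
      continuous_eval_const x
    rw [hA, ofPred_and, ofPred_forall, ofPred_forall]
    simp only [ofPred_forall]
    exact (isClosed_iInter fun x => isClosed_le (h1 x).abs continuous_const).inter
      (isClosed_iInter fun x => isClosed_iInter fun y =>
        isClosed_le (((h1 x).sub (h1 y)).pow 2) continuous_const)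
  let Φ := ContinuousMap.isometryEquivBoundedOfCompact I ℝ
  have key : IsCompact (Φ.symm ⁻¹' A) := by
    refine BoundedContinuousFunction.arzela_ascoli₂ (Icc (-C) C) isCompact_Icc _
      (hcl.preimage Φ.symm.continuous) (fun f x hf => abs_le.1 (hf.1 x)) ?_
    intro x
    rw [Metric.equicontinuousAt_iff]
    intro ε hε
    refine ⟨ε ^ 2 / (|C| + 1), by positivity, fun y hy f => ?_⟩
    have h := f.2.2 x y
    have hdist : |(x : ℝ) - y| < ε ^ 2 / (|C| + 1) := by
      rw [dist_comm] at hy; exact hy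
    rw [lt_div_iff₀ (by positivity)] at hdist
    rw [Real.dist_eq]
    refine abs_lt_of_sq_lt_sq (lt_of_le_of_lt h ?_) hε.le
    nlinarith [abs_nonneg ((x : ℝ) - y), le_abs_self C]
  have := key.image Φ.symm.continuous
  rwa [image_preimage_eq _ Φ.symm.surjective] at this

end UnitCalc

/-! ### The form domain of a metric graph -/

namespace GraphForm

open UnitCalc FormPair

variable {V E : Type*}

/-- Pairs `(f, f')` of a continuously differentiable function on the edges and its derivative,
where `f` is continuous across the vertices. -/
def domSubmodule (G : Multigraph V E) : Submodule ℝ ((E → C(I, ℝ)) × (E → C(I, ℝ))) where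
  carrier := {u | (∀ e, IsDer (u.1 e) (u.2 e)) ∧
    ∃ φ : V → ℝ, ∀ e, u.1 e 0 = φ (G.src e) ∧ u.1 e 1 = φ (G.tgt e)}
  zero_mem' := ⟨fun _ => IsDer.const 0, 0, fun _ => ⟨rfl, rfl⟩⟩
  add_mem' := by
    rintro u v ⟨hu, φ, hφ⟩ ⟨hv, ψ, hψ⟩
    exact ⟨fun e => (hu e).add (hv e), φ + ψ, fun e => by simp [(hφ e).1, (hφ e).2, (hψ e).1, (hψ e).2]⟩
  smul_mem' := by
    rintro c u ⟨hu, φ, hφ⟩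
    exact ⟨fun e => (hu e).smul c, c • φ, fun e => by simp [(hφ e).1, (hφ e).2]⟩

variable {G : Multigraph V E}

/-- The form domain. -/
def Dom (G : Multigraph V E) : Type _ := domSubmodule G

instance : AddCommGroup (Dom G) := inferInstanceAs (AddCommGroup (domSubmodule G))

instance : Module ℝ (Dom G) := inferInstanceAs (Module ℝ (domSubmodule G))

/-- The inclusion of the form domain in the space of pairs. -/
def incl (G : Multigraph V E) : Dom G →ₗ[ℝ] (E → C(I, ℝ)) × (E → C(I, ℝ)) :=
  (domSubmodule G).subtype

/-- The function underlying an element of the form domain. -/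
def val (G : Multigraph V E) : Dom G →ₗ[ℝ] (E → C(I, ℝ)) := LinearMap.fst ℝ _ _ ∘ₗ incl G

/-- The derivative of an element of the form domain. -/
def der (G : Multigraph V E) : Dom G →ₗ[ℝ] (E → C(I, ℝ)) := LinearMap.snd ℝ _ _ ∘ₗ incl G

/-- The element of the form domain with a given value and derivative. -/
def mkDom {f d : E → C(I, ℝ)} (h : ∀ e, IsDer (f e) (d e)) {φ : V → ℝ}
    (hφ : ∀ e, f e 0 = φ (G.src e) ∧ f e 1 = φ (G.tgt e)) : Dom G :=
  (⟨(f, d), h, φ, hφ⟩ : domSubmodule G)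

lemma isDer (u : Dom G) (e : E) : IsDer (val G u e) (der G u e) := u.2.1 e

lemma matches_vertices (u : Dom G) :
    ∃ φ : V → ℝ, ∀ e, val G u e 0 = φ (G.src e) ∧ val G u e 1 = φ (G.tgt e) := u.2.2

/-- The constant functions on the graph. -/
def constDom (G : Multigraph V E) (c : ℝ) : Dom G :=
  mkDom (f := fun _ => ContinuousMap.const I c) (d := 0) (fun _ => IsDer.const c)
    (φ := fun _ => c) fun _ => ⟨rfl, rfl⟩

@[simp] lemma val_constDom (c : ℝ) (e : E) (x : I) : val G (constDom G c) e x = c := rfl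

@[simp] lemma der_constDom (c : ℝ) : der G (constDom G c) = 0 := rfl

lemma val_injective : Function.Injective (val G) := by
  intro u v h
  refine Subtype.ext (Prod.ext h (funext fun e => ?_))
  refine (isDer u e).unique ?_
  rw [h]
  exact isDer v e

lemma constant_of_connected (hG : G.Connected) {φ : V → ℝ} (h : ∀ e, φ (G.src e) = φ (G.tgt e))
    (x y : V) : φ x = φ y := by
  induction hG.2 x y with
  | rel _ _ h' => obtain ⟨e, rfl, rfl⟩ := h'; exact h e
  | refl => rfl
  | symm _ _ _ ih => exact ih.symm
  | trans _ _ _ _ _ ih1 ih2 => exact ih1.trans ih2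

variable [Fintype E]

/-- The weighted inner product on the edges. -/
def wip (w : E → C(I, ℝ)) : (E → C(I, ℝ)) →ₗ[ℝ] (E → C(I, ℝ)) →ₗ[ℝ] ℝ :=
  LinearMap.mk₂ ℝ (fun f h => ∑ e, intg (w e * f e * h e))
    (fun f f' h => by simp [mul_add, add_mul, Finset.sum_add_distrib])
    (fun c f h => by simp [Finset.mul_sum])
    (fun f h h' => by simp [mul_add, Finset.sum_add_distrib])
    (fun c f h => by simp [Finset.mul_sum])

lemma wip_apply (w f h : E → C(I, ℝ)) : wip w f h = ∑ e, intg (w e * f e * h e) := rfl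

lemma wip_symm (w f h : E → C(I, ℝ)) : wip w f h = wip w h f := by
  simp only [wip_apply]
  exact Finset.sum_congr rfl fun e _ => by congr 1; ring

lemma wip_mono {w w' : E → C(I, ℝ)} (h : ∀ e x, w e x ≤ w' e x) (f : E → C(I, ℝ)) :
    wip w f f ≤ wip w' f f := by
  simp only [wip_apply]
  refine Finset.sum_le_sum fun e _ => intg_mono fun x => ?_
  simp only [ContinuousMap.mul_apply, mul_assoc]
  exact mul_le_mul_of_nonneg_right (h e x) (mul_self_nonneg _)

lemma wip_nonneg {w : E → C(I, ℝ)} (h : ∀ e x, 0 ≤ w e x) (f : E → C(I, ℝ)) : 0 ≤ wip w f f := by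
  have := wip_mono (w := 0) h f
  simpa [wip_apply] using this

lemma eq_zero_of_wip_eq_zero {w : E → C(I, ℝ)} (h : ∀ e x, 0 < w e x) {f : E → C(I, ℝ)}
    (h0 : wip w f f = 0) : f = 0 := by
  have hnn : ∀ e x, 0 ≤ (w e * f e * f e) x := fun e x => by
    simp only [ContinuousMap.mul_apply, mul_assoc]
    exact mul_nonneg (h e x).le (mul_self_nonneg _)
  rw [wip_apply, Finset.sum_eq_zero_iff_of_nonneg fun e _ => intg_nonneg (hnn e)] at h0
  ext e x
  have := DFunLike.congr_fun (eq_zero_of_intg_eq_zero (hnn e) (h0 e (Finset.mem_univ e))) x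
  simpa [(h e x).ne'] using this

/-- The Dirichlet form with constant weight `c e` on the edge `e`. -/
def qForm (G : Multigraph V E) (c : E → ℝ) : Dom G →ₗ[ℝ] Dom G →ₗ[ℝ] ℝ :=
  (wip fun e => ContinuousMap.const I (c e)).compl₁₂ (der G) (der G)

/-- The mass form with weight `w`. -/
def bForm (G : Multigraph V E) (w : E → C(I, ℝ)) : Dom G →ₗ[ℝ] Dom G →ₗ[ℝ] ℝ :=
  (wip w).compl₁₂ (val G) (val G)

lemma qForm_apply (c : E → ℝ) (u v : Dom G) :
    qForm G c u v = ∑ e, c e * intg (der G u e * der G v e) := by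
  simp only [qForm, LinearMap.compl₁₂_apply, wip_apply, mul_assoc]
  refine Finset.sum_congr rfl fun e _ => ?_
  exact (congrArg intg (by ext; simp)).trans (map_smul intg (c e) _)

lemma bForm_apply (w : E → C(I, ℝ)) (u v : Dom G) : bForm G w u v = wip w (val G u) (val G v) := rfl

lemma qForm_symm (c : E → ℝ) (u v : Dom G) : qForm G c u v = qForm G c v u := wip_symm _ _ _

lemma bForm_symm (w : E → C(I, ℝ)) (u v : Dom G) : bForm G w u v = bForm G w v u := wip_symm _ _ _

/-- `d` is the derivative of a solution of `-u''/ℓ = s` with Kirchhoff's condition at the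
vertices. -/
def IsSol (G : Multigraph V E) (l : E → ℝ) (s d : E → C(I, ℝ)) : Prop :=
  (∀ e, IsDer (d e) (-(l e • s e))) ∧ open Classical in ∀ v : V,
    ∑ e, ((if G.src e = v then d e 0 / l e else 0)
      + (if G.tgt e = v then -(d e 1 / l e) else 0)) = 0

/-- Integration by parts on each edge. The boundary terms, regrouped by vertex, are the vertex value
of `v` times the Kirchhoff sum of `u`. -/
lemma IsSol.weak [Finite V] {l : E → ℝ} (hl : ∀ e, 0 < l e) {s : E → C(I, ℝ)} {u : Dom G}
    (h : IsSol G l s (der G u)) (v : Dom G) :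
    qForm G (fun e => 1 / l e) u v = ∑ e, intg (s e * val G v e) := by
  classical
  cases nonempty_fintype V
  obtain ⟨φ, hφ⟩ := matches_vertices v
  have h1 : ∀ e, 1 / l e * intg (der G u e * der G v e) - intg (s e * val G v e) =
      der G u e 1 / l e * φ (G.tgt e) - der G u e 0 / l e * φ (G.src e) := fun e => by
    have := ((h.1 e).mul (isDer v e)).intg_eq
    rw [map_add, neg_mul, map_neg, smul_mul_assoc, map_smul, smul_eq_mul] at this
    simp only [ContinuousMap.mul_apply, (hφ e).1, (hφ e).2] at this
    have hle := (hl e).ne'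
    field_simp
    linarith
  have h2 : ∑ x : V, φ x * ∑ e, ((if G.src e = x then der G u e 0 / l e else 0)
      + (if G.tgt e = x then -(der G u e 1 / l e) else 0)) = 0 :=
    Finset.sum_eq_zero fun x _ => by
      have := h.2 x
      rw [mul_eq_zero]; right
      convert this
  simp only [Finset.mul_sum] at h2
  rw [Finset.sum_comm] at h2
  rw [qForm_apply, ← sub_eq_zero, ← Finset.sum_sub_distrib, Finset.sum_congr rfl fun e _ => h1 e,
    ← neg_eq_zero, ← h2, ← Finset.sum_neg_distrib]
  refine Finset.sum_congr rfl fun e _ => ?_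
  simp only [mul_add, Finset.sum_add_distrib, mul_ite, mul_zero, Finset.sum_ite_eq,
    Finset.mem_univ, if_true]
  ring

open Classical in
/-- Solvability of the discrete Poisson equation. -/
lemma exists_potential [Fintype V] (hG : G.Connected) {c : E → ℝ} (hc : ∀ e, 0 < c e) {r : V → ℝ}
    (hr : ∑ v, r v = 0) :
    ∃ φ : V → ℝ, ∀ v, ∑ e, ((if G.src e = v then c e * (φ (G.tgt e) - φ (G.src e)) else 0)
      + (if G.tgt e = v then -(c e * (φ (G.tgt e) - φ (G.src e))) else 0)) = r v := by
  let Λ : (V → ℝ) → V → ℝ := fun φ v =>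
    ∑ e, ((if G.src e = v then c e * (φ (G.tgt e) - φ (G.src e)) else 0)
      + (if G.tgt e = v then -(c e * (φ (G.tgt e) - φ (G.src e))) else 0))
  have hΛ : ∀ φ ψ : V → ℝ, ∑ v, ψ v * Λ φ v =
      -∑ e, c e * (φ (G.tgt e) - φ (G.src e)) * (ψ (G.tgt e) - ψ (G.src e)) := fun φ ψ => by
    simp only [Λ, Finset.mul_sum]
    rw [Finset.sum_comm, ← Finset.sum_neg_distrib]
    refine Finset.sum_congr rfl fun e _ => ?_
    simp only [mul_add, Finset.sum_add_distrib, mul_ite, mul_zero, Finset.sum_ite_eq,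
      Finset.mem_univ, if_true]
    ring
  have hΛ1 : ∀ φ, ∑ v, Λ φ v = 0 := fun φ => by
    have := hΛ φ fun _ => 1
    simpa using this
  -- The graph Laplacian kills constants; adding the total sum makes it injective, hence surjective.
  -- As `Λ φ` sums to zero, a right-hand side of sum zero forces the added term to vanish.
  let T : (V → ℝ) →ₗ[ℝ] (V → ℝ) :=
    { toFun := fun φ v => Λ φ v + ∑ x, φ x
      map_add' := fun φ ψ => by
        ext v
        have : Λ (φ + ψ) v = Λ φ v + Λ ψ v := by
          simp only [Λ, ← Finset.sum_add_distrib, Pi.add_apply]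
          refine Finset.sum_congr rfl fun e _ => ?_
          split_ifs <;> ring
        simp only [this, Pi.add_apply, Finset.sum_add_distrib]
        ring
      map_smul' := fun a φ => by
        ext v
        have : Λ (a • φ) v = a * Λ φ v := by
          simp only [Λ, Finset.mul_sum, Pi.smul_apply, smul_eq_mul]
          refine Finset.sum_congr rfl fun e _ => ?_
          split_ifs <;> ring
        simp only [this, Pi.smul_apply, smul_eq_mul, ← Finset.mul_sum, RingHom.id_apply]
        ring }
  have hT : ∀ φ v, T φ v = Λ φ v + ∑ x, φ x := fun _ _ => rfl
  have hV : 0 < (Fintype.card V : ℝ) := by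
    have := hG.1
    exact_mod_cast Fintype.card_pos
  have hsum : ∀ φ, ∑ v, T φ v = Fintype.card V * ∑ x, φ x := fun φ => by
    simp only [hT, Finset.sum_add_distrib, hΛ1]
    simp
  have hinj : Function.Injective T := by
    rw [← LinearMap.ker_eq_bot, LinearMap.ker_eq_bot']
    intro φ h0
    have h1 : ∑ x, φ x = 0 := by
      have := hsum φ
      rw [h0] at this
      simpa [hV.ne'] using this.symm
    have h2 : ∀ v, Λ φ v = 0 := fun v => by
      have := congrFun h0 v
      rwa [hT, h1, add_zero] at this
    have h3 := hΛ φ φ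
    simp only [h2, mul_zero, Finset.sum_const_zero, mul_assoc] at h3
    rw [eq_comm, neg_eq_zero, Finset.sum_eq_zero_iff_of_nonneg
      fun e _ => mul_nonneg (hc e).le (mul_self_nonneg _)] at h3
    have h4 : ∀ e, φ (G.src e) = φ (G.tgt e) := fun e => by
      have := h3 e (Finset.mem_univ e)
      have := mul_self_eq_zero.1 ((mul_eq_zero.1 this).resolve_left (hc e).ne')
      linarith
    ext v
    have h5 : ∑ x, φ x = Fintype.card V * φ v := by
      rw [Finset.sum_congr rfl fun x _ => constant_of_connected hG h4 x v]
      simp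
    rw [h1] at h5
    simpa [hV.ne'] using h5.symm
  obtain ⟨φ, hφ⟩ := LinearMap.injective_iff_surjective.1 hinj r
  refine ⟨φ, fun v => ?_⟩
  have h1 : ∑ x, φ x = 0 := by
    have := hsum φ
    rw [hφ, hr] at this
    simpa [hV.ne'] using this.symm
  have := congrFun hφ v
  rwa [hT, h1, add_zero] at this

/-- Integrate twice on each edge. The vertex values `φ` determine the remaining affine parts, and
Kirchhoff's condition becomes a discrete Poisson equation for `φ` with conductances `1 / l e`,
solvable because the source has integral zero. -/
lemma exists_sol [Finite V] (hG : G.Connected) {l : E → ℝ} (hl : ∀ e, 0 < l e)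
    {s : E → C(I, ℝ)} (hs : ∑ e, intg (s e) = 0) : ∃ u : Dom G, IsSol G l s (der G u) := by
  classical
  cases nonempty_fintype V
  choose p hp hp0 using fun e => exists_primitive (-(l e • s e))
  choose P hP hP0 using fun e => exists_primitive (p e)
  have hp1 : ∀ e, p e 1 = -(l e * intg (s e)) := fun e => by
    have := (hp e).intg_eq
    rw [map_neg, map_smul, smul_eq_mul, hp0, sub_zero] at this
    exact this.symm
  let r : V → ℝ := fun v => ∑ e, ((if G.src e = v then P e 1 / l e else 0)
      + (if G.tgt e = v then -((P e 1 - p e 1) / l e) else 0))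
  have hr : ∑ v, r v = 0 := by
    simp only [r]
    rw [Finset.sum_comm]
    simp only [Finset.sum_add_distrib, Finset.sum_ite_eq, Finset.mem_univ, if_true, sub_div]
    rw [← Finset.sum_add_distrib, ← neg_eq_zero, ← hs, ← Finset.sum_neg_distrib]
    refine Finset.sum_congr rfl fun e _ => ?_
    rw [hp1]
    have := (hl e).ne'
    field_simp
    ring
  obtain ⟨φ, hφ⟩ := exists_potential hG (fun e => one_div_pos.2 (hl e)) hr
  let a : E → ℝ := fun e => φ (G.tgt e) - φ (G.src e) - P e 1
  let u : Dom G := mkDom (f := fun e => ContinuousMap.const I (φ (G.src e)) + a e • coord + P e)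
    (d := fun e => 0 + a e • 1 + p e)
    (fun e => ((IsDer.const _).add (isDer_coord.smul _)).add (hP e)) (φ := φ)
    fun e => ⟨by simp [hP0], by simp [a]; ring⟩
  have hu : ∀ e, der G u e = 0 + a e • 1 + p e := fun e => rfl
  refine ⟨u, fun e => ?_, fun v => ?_⟩
  · have := ((IsDer.const (a e)).add (hp e)).congr (g' := -(l e • s e)) (zero_add _)
    rw [hu]
    convert this using 1
    ext x
    simp
  · have h0 : ∀ e, der G u e 0 = a e := fun e => by simp [hu, hp0]
    have h1 : ∀ e, der G u e 1 = a e + p e 1 := fun e => by simp [hu]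
    simp only [h0, h1]
    have := hφ v
    rw [← sub_eq_zero, ← Finset.sum_sub_distrib] at this
    refine (Finset.sum_congr rfl fun e _ => ?_).trans this
    have := (hl e).ne'
    simp only [a]
    split_ifs <;> field_simp <;> ring

end GraphForm

/-! ### Spectral theory of the graph forms -/

namespace GraphForm

open UnitCalc FormPair

variable {V E : Type*} {G : Multigraph V E} [Fintype E]

lemma tendsto_wip (w : E → C(I, ℝ)) {x y : ℕ → E → C(I, ℝ)} {f h : E → C(I, ℝ)}
    (hx : Tendsto x atTop (𝓝 f)) (hy : Tendsto y atTop (𝓝 h)) :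
    Tendsto (fun n => wip w (x n) (y n)) atTop (𝓝 (wip w f h)) := by
  simp only [wip_apply]
  refine tendsto_finsetSum _ fun e _ => (continuous_intg.tendsto _).comp ?_
  exact (tendsto_const_nhds.mul (tendsto_pi_nhds.1 hx e)).mul (tendsto_pi_nhds.1 hy e)

omit [Fintype E] in
lemma exists_pos_le [Finite E] {w : E → C(I, ℝ)} (hw : ∀ e x, 0 < w e x) :
    ∃ m > 0, ∀ e x, m ≤ w e x := by
  rcases isEmpty_or_nonempty E with hE | hE
  · exact ⟨1, one_pos, fun e => hE.elim e⟩
  have h : ∀ e, ∃ x, ∀ y, w e x ≤ w e y := fun e => by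
    obtain ⟨x, -, hx⟩ := isCompact_univ.exists_isMinOn (univ_nonempty (α := I))
      (w e).continuous.continuousOn
    exact ⟨x, fun y => hx (mem_univ y)⟩
  choose x hx using h
  obtain ⟨e₀, he₀⟩ := Finite.exists_min fun e => w e (x e)
  exact ⟨_, hw e₀ (x e₀), fun e y => (he₀ e).trans (hx e y)⟩

lemma qForm_nonneg {c : E → ℝ} (hc : ∀ e, 0 ≤ c e) (u : Dom G) : 0 ≤ qForm G c u u :=
  wip_nonneg (fun e _ => hc e) _

lemma bForm_pos {w : E → C(I, ℝ)} (hw : ∀ e x, 0 < w e x) {u : Dom G} (hu : u ≠ 0) :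
    0 < bForm G w u u := by
  refine lt_of_le_of_ne (wip_nonneg (fun e x => (hw e x).le) _) fun h0 => hu ?_
  exact val_injective ((eq_zero_of_wip_eq_zero hw h0.symm).trans (map_zero _).symm)

lemma der_eq_zero {c : E → ℝ} (hc : ∀ e, 0 < c e) {u : Dom G} (hu : qForm G c u u = 0) :
    der G u = 0 := eq_zero_of_wip_eq_zero (fun e _ => hc e) hu

omit [Fintype E] in
lemma eq_constDom (hG : G.Connected) {u : Dom G} (hu : der G u = 0) :
    ∃ c : ℝ, u = c • constDom G 1 := by
  obtain ⟨φ, hφ⟩ := matches_vertices u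
  have h1 : ∀ e x, val G u e x = val G u e 0 := fun e x => by
    have := isDer u e
    rw [hu] at this
    exact this.eq_of_deriv_zero _ _
  have h2 : ∀ e, φ (G.src e) = φ (G.tgt e) := fun e => by
    rw [← (hφ e).1, ← (hφ e).2, h1 e 1]
  obtain ⟨v₀⟩ := hG.1
  refine ⟨φ v₀, val_injective ?_⟩
  ext e x
  rw [h1, (hφ e).1, constant_of_connected hG h2 _ v₀]
  simp

lemma exists_form_bounds {c : E → ℝ} (hc : ∀ e, 0 < c e) {w : E → C(I, ℝ)}
    (hw : ∀ e x, 0 < w e x) : ∃ K > 0, ∀ (u : Dom G) (e : E),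
      intg (val G u e ^ 2) ≤ K * bForm G w u u ∧ intg (der G u e ^ 2) ≤ K * qForm G c u u := by
  have key : ∀ w : E → C(I, ℝ), (∀ e x, 0 < w e x) → ∃ K > 0, ∀ (f : E → C(I, ℝ)) (e : E),
      intg (f e ^ 2) ≤ K * wip w f f := fun w hw => by
    obtain ⟨m, hm, hmw⟩ := exists_pos_le hw
    refine ⟨1 / m, by positivity, fun f e => ?_⟩
    have hnn : ∀ e x, 0 ≤ (w e * f e * f e) x := fun e x => by
      simp only [ContinuousMap.mul_apply, mul_assoc]
      exact mul_nonneg (hw e x).le (mul_self_nonneg _)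
    have h1 : intg (w e * f e * f e) ≤ wip w f f :=
      Finset.single_le_sum (f := fun e => intg (w e * f e * f e))
        (fun e _ => intg_nonneg (hnn e)) (Finset.mem_univ e)
    have h2 : intg (m • f e ^ 2) ≤ intg (w e * f e * f e) := intg_mono fun x => by
      simp only [ContinuousMap.mul_apply, ContinuousMap.smul_apply, smul_eq_mul,
        mul_assoc, sq]
      exact mul_le_mul_of_nonneg_right (hmw e x) (mul_self_nonneg _)
    rw [map_smul, smul_eq_mul] at h2
    rw [one_div, inv_mul_eq_div, le_div_iff₀ hm]
    linarith
  obtain ⟨K₁, hK₁, h₁⟩ := key w hw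
  obtain ⟨K₂, hK₂, h₂⟩ := key (fun e => ContinuousMap.const I (c e)) fun e _ => hc e
  refine ⟨max K₁ K₂, by positivity, fun u e => ⟨(h₁ _ e).trans ?_, (h₂ _ e).trans ?_⟩⟩
  · exact mul_le_mul_of_nonneg_right (le_max_left _ _) (wip_nonneg (fun e x => (hw e x).le) _)
  · exact mul_le_mul_of_nonneg_right (le_max_right _ _) (wip_nonneg (fun e x => (hc e).le) _)

lemma bForm_le_of_sq_le [Nonempty E] (w : E → C(I, ℝ)) : ∃ M > 0, ∀ (u : Dom G) (A : ℝ),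
    (∀ e x, val G u e x ^ 2 ≤ A) → bForm G w u u ≤ M * A := by
  refine ⟨∑ e, ‖w e‖ + 1, by positivity, fun u A h => ?_⟩
  have hA : 0 ≤ A := (sq_nonneg _).trans (h (Classical.arbitrary E) 0)
  rw [bForm_apply, wip_apply, add_mul, Finset.sum_mul, one_mul]
  refine le_add_of_le_of_nonneg (Finset.sum_le_sum fun e _ => ?_) hA
  rw [← intg_const (‖w e‖ * A)]
  refine intg_mono fun x => ?_
  have h1 : w e x ≤ ‖w e‖ := (le_abs_self _).trans ((w e).norm_coe_le_norm x)
  have h2 := h e x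
  simp only [ContinuousMap.mul_apply, ContinuousMap.const_apply, mul_assoc, ← sq]
  exact mul_le_mul h1 h2 (sq_nonneg _) (norm_nonneg _)

/-- Evaluation on a fine grid is injective on the span: a function vanishing on the grid is, by the
Hölder bound, so small compared with its energy, itself at most `|μ| * b`, that `b u u` would be
less than itself once `n > M * K * |μ|`. -/
lemma finiteDimensional_EigSpan [Nonempty E] {c : E → ℝ} (hc : ∀ e, 0 < c e) {w : E → C(I, ℝ)}
    (hw : ∀ e x, 0 < w e x) (μ : ℝ) :
    FiniteDimensional ℝ (EigSpan (qForm G c) (bForm G w) (Iic μ)) := by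
  obtain ⟨K, hK, hb⟩ := exists_form_bounds (G := G) hc hw
  obtain ⟨M, hM, hbM⟩ := bForm_le_of_sq_le (G := G) w
  obtain ⟨n, hn⟩ := exists_nat_gt (M * K * |μ|)
  have hn0 : (0 : ℝ) < n := lt_of_le_of_lt (by positivity) hn
  have hgrid : ∀ i : Fin (n + 1), ((i : ℕ) : ℝ) / n ∈ Icc (0 : ℝ) 1 := fun i =>
    ⟨by positivity, by
      rw [div_le_one hn0]
      exact_mod_cast Nat.lt_succ_iff.1 i.2⟩
  let T₀ : Dom G →ₗ[ℝ] (E × Fin (n + 1) → ℝ) :=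
    { toFun := fun u p => val G u p.1 ⟨_, hgrid p.2⟩
      map_add' := fun u v => by ext p; simp
      map_smul' := fun a u => by ext p; simp }
  let T := T₀ ∘ₗ (EigSpan (qForm G c) (bForm G w) (Iic μ)).subtype
  refine FiniteDimensional.of_injective T (LinearMap.ker_eq_bot.1 (LinearMap.ker_eq_bot'.2 fun u hu => ?_))
  have hq : qForm G c u u ≤ |μ| * bForm G w u u :=
    (Spectral.q_le_of_mem_EigSpan (qForm_symm c) (bForm_symm w)
      (fun u => wip_nonneg (fun e x => (hw e x).le) _) u.2).trans
      (mul_le_mul_of_nonneg_right (le_abs_self μ) (wip_nonneg (fun e x => (hw e x).le) _))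
  have hsq : ∀ e x, val G u e x ^ 2 ≤ 1 / n * (K * (|μ| * bForm G w u u)) := fun e x => by
    have hx0 : 0 ≤ (x : ℝ) * n := mul_nonneg x.2.1 hn0.le
    have hi : ⌊(x : ℝ) * n⌋₊ < n + 1 := by
      rw [Nat.lt_succ_iff]
      refine Nat.floor_le_of_le ?_
      nlinarith [x.2.2]
    have h0 : val G u e ⟨_, hgrid ⟨_, hi⟩⟩ = 0 := congrFun hu (e, ⟨_, hi⟩)
    have h1 := (isDer (u : Dom G) e).hoelder x ⟨_, hgrid ⟨_, hi⟩⟩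
    rw [h0, sub_zero] at h1
    refine h1.trans (mul_le_mul ?_ (((hb u e).2).trans (mul_le_mul_of_nonneg_left hq hK.le))
      (intg_nonneg fun y => sq_nonneg _) (by positivity))
    have h2 := Nat.floor_le hx0
    have h3 := (Nat.lt_floor_add_one ((x : ℝ) * n)).le
    have h4 : (x : ℝ) - (⌊(x : ℝ) * n⌋₊ : ℝ) / n = ((x : ℝ) * n - ⌊(x : ℝ) * n⌋₊) / n := by
      field_simp
    simp only [h4]
    rw [abs_of_nonneg (div_nonneg (by linarith) hn0.le)]
    exact div_le_div_of_nonneg_right (by linarith) hn0.le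
  have h1 := hbM u _ hsq
  have hb0 : bForm G w u u = 0 := by
    refine le_antisymm ?_ (wip_nonneg (fun e x => (hw e x).le) _)
    by_contra! hpos
    have : M * (1 / n * (K * (|μ| * bForm G w u u))) = (M * K * |μ|) * bForm G w u u / n := by
      field_simp
    rw [this, le_div_iff₀ hn0] at h1
    nlinarith
  by_contra hne
  exact (bForm_pos hw (u := (u : Dom G)) (by simpa using hne)).ne' hb0

omit [Fintype E] in
lemma exists_isDer_polynomial (p : Polynomial ℝ) :
    ∃ f f' : C(I, ℝ), IsDer f f' ∧ ∀ x : I, f x = p.eval (x : ℝ) := by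
  refine ⟨⟨fun x => p.eval (x : ℝ), by fun_prop⟩, ⟨fun x => p.derivative.eval (x : ℝ), by fun_prop⟩,
    fun x => ?_, fun _ => rfl⟩
  exact ((p.hasDerivAt (x : ℝ)).hasDerivWithinAt (s := Icc 0 1)).congr
    (fun y hy => by rw [ext_of_mem _ hy]; rfl) (by rw [ext_coe]; rfl)

-- Multiples of `x (1 - x)` vanish at every vertex, so every polynomial gives an element of the
-- domain.
omit [Fintype E] in
lemma not_finiteDimensional_Dom [Nonempty E] : ¬ FiniteDimensional ℝ (Dom G) := by
  intro hfin
  open Polynomial in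
  choose f f' hf hfp using fun p : ℝ[X] => exists_isDer_polynomial ((X * (1 - X)) * p)
  let F : Polynomial ℝ → Dom G := fun p =>
    mkDom (f := fun _ => f p) (d := fun _ => f' p) (fun _ => hf p) (φ := 0) fun _ => by simp [hfp]
  let T : Polynomial ℝ →ₗ[ℝ] Dom G :=
    { toFun := F
      map_add' := fun p r => val_injective (by
        ext e x
        change f (p + r) x = f p x + f r x
        simp only [hfp, Polynomial.eval_mul, Polynomial.eval_add]
        ring)
      map_smul' := fun a p => val_injective (by
        ext e x
        change f (a • p) x = a * f p x
        simp only [hfp, Polynomial.eval_mul, Polynomial.eval_smul, smul_eq_mul]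
        ring) }
  have hT : Function.Injective T := by
    rw [← LinearMap.ker_eq_bot, LinearMap.ker_eq_bot']
    intro p hp
    have h0 : ∀ x : I, ((Polynomial.X * (1 - Polynomial.X)) * p).eval (x : ℝ) = 0 := fun x => by
      rw [← hfp]
      exact DFunLike.congr_fun (congrFun (congrArg (val G) hp) (Classical.arbitrary E)) x
    have h1 : (Polynomial.X * (1 - Polynomial.X)) * p = 0 :=
      Polynomial.eq_zero_of_infinite_isRoot _ ((Icc_infinite zero_lt_one).mono
        fun x hx => h0 ⟨x, hx⟩)
    refine (mul_eq_zero.1 h1).resolve_left (mul_ne_zero Polynomial.X_ne_zero fun h => ?_)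
    have := congrArg (Polynomial.eval 0) h
    simp at this
  exact Polynomial.not_finite (FiniteDimensional.of_injective T hT)

lemma exists_minimizing_sequence {W : Type*} [AddCommGroup W] [Module ℝ W]
    {q b : W →ₗ[ℝ] W →ₗ[ℝ] ℝ} (hq0 : ∀ u, 0 ≤ q u u) (hb0 : ∀ u, 0 ≤ b u u) (Y : Submodule ℝ W)
    {μ : ℝ} {u₀ : W} (hu₀ : u₀ ∈ Y) (hlt : q u₀ u₀ < μ * b u₀ u₀) (hu₀b : 0 < b u₀ u₀) :
    ∃ m, 0 ≤ m ∧ m < μ ∧ (∀ u ∈ Y, m * b u u ≤ q u u) ∧ ∃ U : ℕ → W, (∀ n, U n ∈ Y) ∧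
      (∀ n, b (U n) (U n) = 1) ∧ (∀ n, q (U n) (U n) ≤ m + 1) ∧
      Tendsto (fun n => q (U n) (U n)) atTop (𝓝 m) := by
  let S : Set ℝ := {s | ∃ u ∈ Y, b u u = 1 ∧ q u u = s}
  have hscale : ∀ u ∈ Y, 0 < b u u → q u u / b u u ∈ S := fun u hu hpos => by
    refine ⟨(1 / √(b u u)) • u, Y.smul_mem _ hu, ?_, ?_⟩
    · simp only [map_smul, LinearMap.smul_apply, smul_eq_mul]
      rw [← mul_assoc, ← sq, div_pow, one_pow, Real.sq_sqrt hpos.le]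
      field_simp
    · simp only [map_smul, LinearMap.smul_apply, smul_eq_mul]
      rw [← mul_assoc, ← sq, div_pow, one_pow, Real.sq_sqrt hpos.le]
      field_simp
  have hSb : BddBelow S := ⟨0, by rintro _ ⟨u, -, -, rfl⟩; exact hq0 u⟩
  have hSne : S.Nonempty := ⟨_, hscale u₀ hu₀ hu₀b⟩
  have hm0 : 0 ≤ sInf S := le_csInf hSne (by rintro _ ⟨u, -, -, rfl⟩; exact hq0 u)
  have hYm : ∀ u ∈ Y, sInf S * b u u ≤ q u u := fun u hu => by
    rcases (hb0 u).eq_or_lt with h | h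
    · rw [← h, mul_zero]; exact hq0 u
    · have := csInf_le hSb (hscale u hu h)
      rwa [le_div_iff₀ h] at this
  have hseq : ∀ n : ℕ, ∃ u ∈ Y, b u u = 1 ∧ q u u < sInf S + 1 / (n + 1) := fun n => by
    obtain ⟨_, ⟨u, hu, hu1, rfl⟩, h⟩ := exists_lt_of_csInf_lt hSne
      (show sInf S < sInf S + 1 / ((n : ℝ) + 1) from lt_add_of_pos_right _ (by positivity))
    exact ⟨u, hu, hu1, h⟩
  choose U hUY hU1 hUq using hseq
  refine ⟨sInf S, hm0,
    lt_of_le_of_lt (csInf_le hSb (hscale u₀ hu₀ hu₀b)) (by rwa [div_lt_iff₀ hu₀b]), hYm, U, hUY,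
    hU1, fun n => (hUq n).le.trans ?_, ?_⟩
  · have : 1 / ((n : ℝ) + 1) ≤ 1 := by
      rw [div_le_one (by positivity)]; linarith [(Nat.cast_nonneg n : (0 : ℝ) ≤ n)]
    linarith
  · refine tendsto_of_tendsto_of_tendsto_of_le_of_le tendsto_const_nhds
      (h := fun n : ℕ => sInf S + 1 / ((n : ℝ) + 1)) ?_ (fun n => ?_) fun n => (hUq n).le
    · simpa using tendsto_one_div_add_atTop_nhds_zero_nat.const_add (sInf S)
    · have := hYm _ (hUY n)
      rwa [hU1, mul_one] at this

/-- Bounded energy gives uniform and Hölder bounds, hence uniform convergence. The limit is merely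
continuous and need not come from `Dom G`. -/
lemma exists_subseq_tendsto {c : E → ℝ} (hc : ∀ e, 0 < c e)
    {w : E → C(I, ℝ)} (hw : ∀ e x, 0 < w e x) {A : ℝ} {U : ℕ → Dom G}
    (hU1 : ∀ n, bForm G w (U n) (U n) = 1) (hUA : ∀ n, qForm G c (U n) (U n) ≤ A) :
    ∃ f : E → C(I, ℝ), ∃ φ : ℕ → ℕ, StrictMono φ ∧
      Tendsto (fun n => val G (U (φ n))) atTop (𝓝 f) := by
  obtain ⟨K, hK, hKb⟩ := exists_form_bounds (G := G) hc hw
  have hA : 0 ≤ A := (qForm_nonneg (fun e => (hc e).le) _).trans (hUA 0)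
  set C := 2 * K + 2 * (K * A) + 1 with hC
  have hC0 : 0 ≤ C := by positivity
  obtain ⟨f, -, φ, hφ, hf⟩ := (isCompact_univ_pi fun _ : E => isCompact_hoelder C).tendsto_subseq
    (x := fun n => val G (U n)) fun n e _ => by
      have hb1 := (hKb (U n) e).1
      have hb2 := (hKb (U n) e).2
      rw [hU1, mul_one] at hb1
      have h4 := mul_le_mul_of_nonneg_left (hUA n) hK.le
      have hKm : 0 ≤ K * A := by positivity
      refine ⟨fun x => ?_, fun x y => ?_⟩
      · have h5 := (isDer (U n) e).sq_le x
        refine abs_le_of_sq_le_sq ?_ hC0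
        nlinarith
      · refine ((isDer (U n) e).hoelder x y).trans
          (mul_le_mul_of_nonneg_left ?_ (abs_nonneg _))
        linarith
  exact ⟨f, φ, hφ, hf⟩

/-- The solution of the weak equation `q u = b f` inside the orthogonal complement of the
eigenspaces below a positive number. -/
lemma exists_weak_solution [Finite V] [Nonempty E] (hG : G.Connected) {l : E → ℝ}
    (hl : ∀ e, 0 < l e) {w : E → C(I, ℝ)} (hw : ∀ e x, 0 < w e x) {μ : ℝ} (hμ : 0 < μ)
    {f : E → C(I, ℝ)}
    (hf : ∀ n ∈ EigSpan (qForm G fun e => 1 / l e) (bForm G w) (Iio μ), wip w f (val G n) = 0) :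
    ∃ u : Dom G, (∀ v, qForm G (fun e => 1 / l e) u v = wip w f (val G v)) ∧
      ∀ n ∈ EigSpan (qForm G fun e => 1 / l e) (bForm G w) (Iio μ), bForm G w u n = 0 := by
  set q := qForm G fun e => 1 / l e with hq
  set b := bForm G w with hb
  have hone : constDom G 1 ∈ Eig q b 0 := mem_Eig.2 fun v => by
    simp [q, qForm_apply]
  have hf1 := hf _ (Eig_le_EigSpan q b (mem_Iio.2 hμ) hone)
  obtain ⟨u', hu'⟩ := exists_sol hG hl (s := fun e => w e * f e) (by
    rw [← hf1, wip_apply]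
    refine Finset.sum_congr rfl fun e _ => ?_
    congr 1; ext x; simp)
  have hb1 : 0 < b (constDom G 1) (constDom G 1) := bForm_pos hw fun h => by
    have := DFunLike.congr_fun (congrFun (congrArg (val G) h) (Classical.arbitrary E)) 0
    simp at this
  -- The free additive constant makes `u` orthogonal to the kernel of `q`; orthogonality to the
  -- other eigenspaces follows by testing the equation against them.
  set u := u' - (b u' (constDom G 1) / b (constDom G 1) (constDom G 1)) • constDom G 1 with hu
  have hqu : ∀ v, q u v = wip w f (val G v) := fun v => by
    have h1 : q u v = q u' v := by
      rw [hu, map_sub, map_smul, LinearMap.sub_apply, LinearMap.smul_apply, mem_Eig.1 hone]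
      simp
    rw [h1, hu'.weak hl v, wip_apply]
  have hub : b u (constDom G 1) = 0 := by
    rw [hu, map_sub, map_smul, LinearMap.sub_apply, LinearMap.smul_apply, smul_eq_mul,
      div_mul_cancel₀ _ hb1.ne', sub_self]
  refine ⟨u, hqu, fun n hn => Spectral.orthogonal_EigSpan (fun ν hν n hn => ?_) hn⟩
  by_cases hν0 : ν = 0
  · subst hν0
    have h1 := mem_Eig.1 hn n
    rw [zero_mul] at h1
    obtain ⟨c, rfl⟩ := eq_constDom hG (der_eq_zero (fun e => one_div_pos.2 (hl e)) h1)
    rw [map_smul, hub, smul_zero]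
  · have h1 := mem_Eig.1 hn u
    rw [hq, qForm_symm, ← hq, hqu, hf n (Eig_le_EigSpan q b hν hn), hb, bForm_symm] at h1
    exact (mul_eq_zero.1 h1.symm).resolve_left hν0

/-- Otherwise the infimum `m` of the Rayleigh quotient on the orthogonal complement `Y` is below
`μ`. The uniform limit `f` of a minimising sequence may lack a derivative, so one solves `q u = b f`
weakly inside `Y` and shows `f = m • u`. Then `u` is an eigenvector for `m < μ`, hence orthogonal to
itself. -/
lemma gap_inequality [Finite V] [Nonempty E] (hG : G.Connected) {l : E → ℝ} (hl : ∀ e, 0 < l e)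
    {w : E → C(I, ℝ)} (hw : ∀ e x, 0 < w e x) (μ : ℝ) (u₀ : Dom G)
    (hu₀ : ∀ n ∈ EigSpan (qForm G fun e => 1 / l e) (bForm G w) (Iio μ), bForm G w u₀ n = 0) :
    μ * bForm G w u₀ u₀ ≤ qForm G (fun e => 1 / l e) u₀ u₀ := by
  by_contra! hlt
  set q := qForm G fun e => 1 / l e with hq
  set b := bForm G w with hb
  have hc : ∀ e, 0 < 1 / l e := fun e => one_div_pos.2 (hl e)
  have hq0 : ∀ u, 0 ≤ q u u := qForm_nonneg fun e => (hc e).le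
  have hqs : ∀ u v, q u v = q v u := qForm_symm _
  have hb0 : ∀ u, 0 ≤ b u u := fun u => wip_nonneg (fun e x => (hw e x).le) _
  have hu₀b : 0 < b u₀ u₀ := by
    refine bForm_pos hw fun h => ?_
    simp [h] at hlt
  let Y : Submodule ℝ (Dom G) :=
    { carrier := {u | ∀ n ∈ EigSpan q b (Iio μ), b u n = 0}
      zero_mem' := fun n _ => by simp
      add_mem' := fun hu hv n hn => by simp [hu n hn, hv n hn]
      smul_mem' := fun a u hu n hn => by simp [hu n hn] }
  obtain ⟨m, hm0, hmμ, hYm, U, hUY, hU1, hUA, hUlim⟩ :=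
    exists_minimizing_sequence hq0 hb0 Y hu₀ hlt hu₀b
  obtain ⟨f, φ, hφ, hf⟩ := exists_subseq_tendsto hc hw hU1 hUA
  have hUlim' := hUlim.comp hφ.tendsto_atTop
  have hlim : ∀ h : E → C(I, ℝ), Tendsto (fun n => wip w (val G (U (φ n))) h) atTop
      (𝓝 (wip w f h)) := fun h =>
    tendsto_wip w hf tendsto_const_nhds
  have hff : wip w f f = 1 := by
    have h1 := tendsto_wip w hf hf
    simp only [← bForm_apply, ← hb, hU1] at h1
    exact tendsto_nhds_unique h1 tendsto_const_nhds
  obtain ⟨u, hqu, huY⟩ := exists_weak_solution hG hl hw (hm0.trans_lt hmμ) (f := f) fun n hn => by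
    have h1 := hlim (val G n)
    have h2 : ∀ k, b (U (φ k)) n = 0 := fun k => hUY (φ k) n hn
    simp only [← bForm_apply, ← hb, h2] at h1
    exact tendsto_nhds_unique h1 tendsto_const_nhds
  rw [← hq] at hqu
  set β := q u u with hβ
  have hβf : β = wip w f (val G u) := hqu u
  have hexp : ∀ s : ℝ, Tendsto (fun n => q (U (φ n) - s • u) (U (φ n) - s • u)) atTop
      (𝓝 (m - 2 * s + s ^ 2 * β)) := fun s => by
    have h1 : ∀ n, q (U (φ n) - s • u) (U (φ n) - s • u) =
        q (U (φ n)) (U (φ n)) - 2 * s * wip w (val G (U (φ n))) f + s ^ 2 * β := fun n => by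
      rw [wip_symm w _ f, ← hqu]
      simp only [map_sub, map_smul, LinearMap.sub_apply, LinearMap.smul_apply, smul_eq_mul,
        hqs _ u]
      ring
    simp only [h1]
    have := ((hUlim'.sub ((hlim f).const_mul (2 * s))).add_const (s ^ 2 * β))
    rwa [hff, mul_one] at this
  have hwip : ∀ s : ℝ, wip w (f - s • val G u) (f - s • val G u) =
      1 - 2 * s * β + s ^ 2 * b u u := fun s => by
    rw [hb, bForm_apply, hβf]
    simp only [map_sub, map_smul, LinearMap.sub_apply, LinearMap.smul_apply, smul_eq_mul,
      wip_symm w (val G u) f, hff]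
    ring
  rcases hm0.eq_or_lt with hm0 | hm0
  -- For `m = 0` the limit in `hexp` is `-2 * s + s ^ 2 * β`, which is negative at `s = 1 / (β + 1)`
  -- although it is a limit of energies.
  · have hβ0 : 0 ≤ β := hq0 u
    have := ge_of_tendsto' (hexp (1 / (β + 1))) fun n => hq0 _
    rw [← hm0] at this
    have h2 : 0 - 2 * (1 / (β + 1)) + (1 / (β + 1)) ^ 2 * β = -(β + 2) / (β + 1) ^ 2 := by
      field_simp; ring
    rw [h2] at this
    have h3 : -(β + 2) / (β + 1) ^ 2 < 0 := div_neg_of_neg_of_pos (by linarith) (by positivity)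
    linarith
  · have hf' := hf.sub_const (m • val G u)
    -- The minimality of `m`, applied to `U (φ n) - m • u`, passes to the limit. Minimality at `u`
    -- gives `m * β ≤ 1`, which makes the right side nonpositive.
    have hge : m * wip w (f - m • val G u) (f - m • val G u) ≤ m - 2 * m + m ^ 2 * β := by
      refine le_of_tendsto_of_tendsto'
        ((tendsto_wip w hf' hf').const_mul m) (hexp m) fun n => ?_
      have := hYm (U (φ n) - m • u) (Y.sub_mem (hUY _) (Y.smul_mem _ huY))
      rw [hb, bForm_apply, map_sub, map_smul] at this
      exact this
    have hnn : 0 ≤ wip w (f - m • val G u) (f - m • val G u) :=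
      wip_nonneg (fun e x => (hw e x).le) _
    have hβm := hYm u huY
    have h0 : wip w (f - m • val G u) (f - m • val G u) = 0 := by
      refine le_antisymm ?_ hnn
      have h1 : m * β ≤ 1 := by
        rw [hwip] at hnn
        nlinarith
      by_contra! hpos
      nlinarith [mul_pos hm0 hpos]
    have hfu : f = m • val G u := sub_eq_zero.1 (eq_zero_of_wip_eq_zero hw h0)
    have hue : u ∈ Eig q b m := mem_Eig.2 fun v => by
      rw [hqu, hfu, map_smul, LinearMap.smul_apply, smul_eq_mul, hb, bForm_apply]
    have hbu : b u u = 0 := huY u (Eig_le_EigSpan q b (mem_Iio.2 hmμ) hue)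
    rw [hfu] at hff
    simp only [map_smul, LinearMap.smul_apply, smul_eq_mul] at hff
    rw [← bForm_apply, ← hb, hbu] at hff
    simp at hff

theorem spectral [Finite V] [Nonempty E] (hG : G.Connected) {l : E → ℝ} (hl : ∀ e, 0 < l e)
    {w : E → C(I, ℝ)} (hw : ∀ e x, 0 < w e x) :
    Spectral (qForm G fun e => 1 / l e) (bForm G w) where
  q_symm := qForm_symm _
  b_symm := bForm_symm _
  q_nonneg := qForm_nonneg fun e => (one_div_pos.2 (hl e)).le
  b_pos _ := bForm_pos hw
  finite := finiteDimensional_EigSpan (fun e => one_div_pos.2 (hl e)) hw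
  gap := gap_inequality hG hl hw
  infinite := not_finiteDimensional_Dom

lemma finrank_Eig_zero_le (hG : G.Connected) {l : E → ℝ} (hl : ∀ e, 0 < l e)
    (w : E → C(I, ℝ)) : Module.finrank ℝ (Eig (qForm G fun e => 1 / l e) (bForm G w) 0) ≤ 1 := by
  have : Eig (qForm G fun e => 1 / l e) (bForm G w) 0 ≤ Submodule.span ℝ {constDom G 1} := by
    intro u hu
    have h1 := mem_Eig.1 hu u
    rw [zero_mul] at h1
    obtain ⟨c, rfl⟩ := eq_constDom hG (der_eq_zero (fun e => one_div_pos.2 (hl e)) h1)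
    exact Submodule.mem_span_singleton.2 ⟨c, rfl⟩
  exact (Submodule.finrank_mono this).trans ((finrank_span_le_card _).trans (by simp))

end GraphForm

/-! ### Comparison with the classical eigenvalue problem -/

namespace GraphForm

open UnitCalc FormPair QuantumGraph

variable {V E : Type*} {G : Multigraph V E} [Fintype E]

/-- The function on the edges underlying an element of the form domain. -/
def toEdgeFun (G : Multigraph V E) : Dom G →ₗ[ℝ] EdgeFun E where
  toFun u e x := val G u e x
  map_add' u v := by ext; simp
  map_smul' c u := by ext; simp

omit [Fintype E] in
lemma toEdgeFun_apply (u : Dom G) (e : E) (x : I) : toEdgeFun G u e x = val G u e x := rfl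

omit [Fintype E] in
lemma toEdgeFun_injective : Function.Injective (toEdgeFun G) := fun u v h =>
  val_injective (by ext e x; exact congrFun (congrFun h e) x)

omit [Fintype E] in
lemma onEdge_toEdgeFun (u : Dom G) (e : E) : onEdge (toEdgeFun G u) e = ext (val G u e) := rfl

lemma _root_.UnitCalc.IsDer.derivWithin_eq {f f' : C(I, ℝ)} (h : IsDer f f') {x : ℝ}
    (hx : x ∈ Icc (0 : ℝ) 1) : derivWithin (ext f) (Icc 0 1) x = ext f' x := by
  rw [ext_of_mem f' hx]
  exact (h ⟨x, hx⟩).derivWithin (uniqueDiffOn_Icc zero_lt_one x hx)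

lemma _root_.UnitCalc.IsDer.iteratedDerivWithin_two {f f' f'' : C(I, ℝ)} (h : IsDer f f')
    (h' : IsDer f' f'') {x : ℝ} (hx : x ∈ Icc (0 : ℝ) 1) :
    iteratedDerivWithin 2 (ext f) (Icc 0 1) x = ext f'' x := by
  rw [iteratedDerivWithin_succ, ← h'.derivWithin_eq hx]
  refine derivWithin_congr (fun y hy => ?_) ?_
  · rw [iteratedDerivWithin_one, h.derivWithin_eq hy]
  · rw [iteratedDerivWithin_one, h.derivWithin_eq hx]

lemma _root_.UnitCalc.IsDer.contDiffOn_succ {n : WithTop ℕ∞} (hn : n ≠ ω) {f f' : C(I, ℝ)}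
    (h : IsDer f f') (hf' : ContDiffOn ℝ n (ext f') (Icc 0 1)) :
    ContDiffOn ℝ (n + 1) (ext f) (Icc 0 1) := by
  rw [contDiffOn_succ_iff_derivWithin (uniqueDiffOn_Icc zero_lt_one)]
  refine ⟨fun x hx => (h ⟨x, hx⟩).differentiableWithinAt, fun h => absurd h hn, ?_⟩
  exact hf'.congr fun x hx => h.derivWithin_eq hx

lemma _root_.UnitCalc.exists_isDer {f : C(I, ℝ)} {n : WithTop ℕ∞}
    (h : ContDiffOn ℝ (n + 1) (ext f) (Icc 0 1)) :
    ∃ f', IsDer f f' ∧ ContDiffOn ℝ n (ext f') (Icc 0 1) := by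
  obtain ⟨h1, -, h2⟩ := (contDiffOn_succ_iff_derivWithin (uniqueDiffOn_Icc zero_lt_one)).1 h
  refine ⟨⟨fun x => derivWithin (ext f) (Icc 0 1) x, ?_⟩, fun x => ?_, ?_⟩
  · exact continuousOn_iff_continuous_domRestrict.1 h2.continuousOn
  · exact (h1 x x.2).hasDerivWithinAt
  · exact h2.congr fun x hx => ext_of_mem _ hx

lemma kirchhoffSum_toEdgeFun (g : E → ℝ) (u : Dom G) (v : V) :
    kirchhoffSum G g (toEdgeFun G u) v = open Classical in
      ∑ e, ((if G.src e = v then der G u e 0 / √(g e) else 0)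
      + (if G.tgt e = v then -(der G u e 1 / √(g e)) else 0)) := by
  have h0 : ∀ e, edgeDeriv (toEdgeFun G u) e 0 = der G u e 0 := fun e => by
    rw [edgeDeriv, onEdge_toEdgeFun, (isDer u e).derivWithin_eq (by simp)]
    exact ext_coe _ 0
  have h1 : ∀ e, edgeDeriv (toEdgeFun G u) e 1 = der G u e 1 := fun e => by
    rw [edgeDeriv, onEdge_toEdgeFun, (isDer u e).derivWithin_eq (by simp)]
    exact ext_coe _ 1
  simp only [kirchhoffSum, h0, h1]

variable {g : E → ℝ} (hg : IsMetric g) {ρ : EdgeFun E} {w : E → C(I, ℝ)}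
  (hw : ∀ e x, w e x = √(g e) * ρ e x)

include hg hw

omit [Fintype E] in
lemma sqrt_smul_weight (e : E) (x : I) : √(g e) * w e x = g e * ρ e x := by
  rw [hw, ← mul_assoc, Real.mul_self_sqrt (hg e).le]

-- Regularity without bootstrapping: solve the strong problem with source `ν w u`. The solution has
-- the same weak form as `u`, so the derivatives agree.
omit hw in
lemma isSol_of_mem_Eig [Finite V] (hG : G.Connected) {ν : ℝ} {u : Dom G}
    (hu : u ∈ Eig (qForm G fun e => 1 / √(g e)) (bForm G w) ν) :
    IsSol G (fun e => √(g e)) (fun e => ν • (w e * val G u e)) (der G u) := by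
  have hl : ∀ e, 0 < √(g e) := fun e => Real.sqrt_pos.2 (hg e)
  have hu := mem_Eig.1 hu
  obtain ⟨u', hu'⟩ := exists_sol hG hl (s := fun e => ν • (w e * val G u e)) (by
    have := hu (constDom G 1)
    rw [qForm_symm, qForm_apply] at this
    simp only [der_constDom, Pi.zero_apply, zero_mul, map_zero, mul_zero,
      Finset.sum_const_zero] at this
    rw [this, bForm_apply, wip_apply, Finset.mul_sum]
    refine Finset.sum_congr rfl fun e _ => ?_
    rw [map_smul, smul_eq_mul]
    congr 2; ext x; simp)
  have hweak : ∀ v, qForm G (fun e => 1 / √(g e)) u' v = qForm G (fun e => 1 / √(g e)) u v :=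
    fun v => by
      rw [hu'.weak hl, hu, bForm_apply, wip_apply, Finset.mul_sum]
      refine Finset.sum_congr rfl fun e _ => ?_
      rw [smul_mul_assoc, map_smul, smul_eq_mul]
  have hder : der G (u' - u) = 0 := der_eq_zero (fun e => one_div_pos.2 (hl e)) (by
    rw [map_sub (qForm G fun e => 1 / √(g e)), LinearMap.sub_apply, hweak, sub_self])
  rw [map_sub, sub_eq_zero] at hder
  rwa [hder] at hu'

lemma map_Eig_le [Finite V] (hG : G.Connected) (ν : ℝ) :
    (Eig (qForm G fun e => 1 / √(g e)) (bForm G w) ν).map (toEdgeFun G) ≤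
      eigenspace G g ρ ν := by
  rintro _ ⟨u, hu, rfl⟩
  obtain ⟨h1, h2⟩ := isSol_of_mem_Eig hg hG hu
  refine ⟨fun e => ?_, fun e x => ?_, ?_, fun v => ?_⟩
  · rw [onEdge_toEdgeFun]
    have h3 : ContDiffOn ℝ (0 + 1) (ext (der G u e)) (Icc 0 1) :=
      (h1 e).contDiffOn_succ (by simp) (contDiffOn_zero.2 (continuous_ext _).continuousOn)
    have h4 := (isDer u e).contDiffOn_succ (by simp) h3
    exact h4.of_le (by norm_num)
  · have hge := (hg e).ne'
    rw [edgeDeriv2, onEdge_toEdgeFun, (isDer u e).iteratedDerivWithin_two (h1 e) x.2, ext_coe]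
    have h3 := sqrt_smul_weight hg hw e x
    simp only [ContinuousMap.neg_apply, ContinuousMap.smul_apply, ContinuousMap.mul_apply,
      smul_eq_mul, toEdgeFun_apply]
    have h4 : √(g e) * (ν * (w e x * val G u e x)) = ν * (g e * ρ e x) * val G u e x := by
      rw [← h3]; ring
    rw [h4]
    field_simp
  · exact matches_vertices u
  · rw [kirchhoffSum_toEdgeFun]
    exact h2 v

lemma eigenspace_le_map [Finite V] (ν : ℝ) :
    eigenspace G g ρ ν ≤
      (Eig (qForm G fun e => 1 / √(g e)) (bForm G w) ν).map (toEdgeFun G) := by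
  have hl : ∀ e, 0 < √(g e) := fun e => Real.sqrt_pos.2 (hg e)
  rintro f ⟨hf1, hf2, ⟨φ, hφ⟩, hf4⟩
  have hfc : ∀ e, Continuous (f e) := fun e => by
    have := continuousOn_iff_continuous_domRestrict.1 (hf1 e).continuousOn
    have h2 : (Icc (0 : ℝ) 1).domRestrict (onEdge f e) = f e :=
      funext fun x => IccExtend_val _ _ x
    rwa [h2] at this
  let F : E → C(I, ℝ) := fun e => ⟨f e, hfc e⟩
  have hF : ∀ e, onEdge f e = ext (F e) := fun e => rfl
  have hder : ∀ e, ∃ f' f'', IsDer (F e) f' ∧ IsDer f' f'' := fun e => by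
    have h1 : ContDiffOn ℝ (1 + 1) (ext (F e)) (Icc 0 1) := (hf1 e).of_le (by norm_num)
    obtain ⟨f', hf', h2⟩ := UnitCalc.exists_isDer h1
    obtain ⟨f'', hf'', -⟩ := UnitCalc.exists_isDer (n := 0) (by simpa using h2)
    exact ⟨f', f'', hf', hf''⟩
  choose F' F'' hF' hF'' using hder
  let u : Dom G := mkDom hF' hφ
  have hu : toEdgeFun G u = f := rfl
  refine ⟨u, mem_Eig.2 fun v => ?_, hu⟩
  have hsol : IsSol G (fun e => √(g e)) (fun e => ν • (w e * F e)) (der G u) := by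
    refine ⟨fun e => (hF'' e).congr ?_, fun v => ?_⟩
    · ext x
      have h1 := hf2 e x
      rw [edgeDeriv2, hF, (hF' e).iteratedDerivWithin_two (hF'' e) x.2, ext_coe] at h1
      have h3 := sqrt_smul_weight hg hw e x
      have h4 : √(g e) * (ν * (w e x * f e x)) = ν * (g e * ρ e x) * f e x := by
        rw [← h3]; ring
      change F'' e x = -(√(g e) * (ν * (w e x * f e x)))
      have hge := (hg e).ne'
      rw [h4]
      field_simp at h1
      linarith
    · have := hf4 v
      rwa [← hu, kirchhoffSum_toEdgeFun] at this
  rw [hsol.weak hl, bForm_apply, wip_apply, Finset.mul_sum]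
  refine Finset.sum_congr rfl fun e _ => ?_
  rw [smul_mul_assoc, map_smul, smul_eq_mul]
  rfl

theorem eigenspace_eq_map [Finite V] (hG : G.Connected) (ν : ℝ) :
    eigenspace G g ρ ν =
      (Eig (qForm G fun e => 1 / √(g e)) (bForm G w) ν).map (toEdgeFun G) :=
  le_antisymm (eigenspace_le_map hg hw ν) (map_Eig_le hg hw hG ν)

theorem eigenvalue_eq_lam [Finite V] (hG : G.Connected) (k : ℕ) :
    eigenvalue G k g ρ = lam (qForm G fun e => 1 / √(g e)) (bForm G w) k := by
  have key : ∀ μ, (⨆ ν ∈ Iic μ, eigenspace G g ρ ν) =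
      (EigSpan (qForm G fun e => 1 / √(g e)) (bForm G w) (Iic μ)).map (toEdgeFun G) := fun μ => by
    simp only [eigenspace_eq_map hg hw hG, EigSpan, Submodule.map_iSup]
  unfold eigenvalue lam
  congr 1
  ext μ
  rw [mem_ofPred_eq, mem_ofPred_eq, key, rank_map_eq toEdgeFun_injective]

end GraphForm

/-! ### Variations of the metric and the density -/

namespace GraphForm

open UnitCalc FormPair QuantumGraph

/-- `F` need not be differentiable, as happens at multiple eigenvalues; one-sided comparison with
`Φ` suffices. -/
lemma not_le_or_ge_of_hasDerivAt {F Φ : ℝ → ℝ} {d F₀ : ℝ} (hd : 0 < d) (hΦ : HasDerivAt Φ d 0)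
    (h0 : Φ 0 = F₀)
    (h : ∀ᶠ t in 𝓝 0, (0 ≤ t → Φ t ≤ F t) ∧ (t ≤ 0 → F t ≤ Φ t)) :
    ¬ (LeUpToLittleO F (fun _ => F₀) ∨ GeUpToLittleO F (fun _ => F₀)) := by
  rw [hasDerivAt_iff_isLittleO] at hΦ
  simp only [sub_zero, h0, smul_eq_mul] at hΦ
  have h1 := hΦ.def (show 0 < d / 4 by positivity)
  simp only [Real.norm_eq_abs] at h1
  rintro (⟨r, hr, hle⟩ | ⟨r, hr, hle⟩)
  · have h2 := hr.def (show 0 < d / 4 by positivity)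
    simp only [Real.norm_eq_abs] at h2
    obtain ⟨t, ⟨⟨⟨h1, h2⟩, h⟩, hle⟩, ht⟩ :=
      (((((h1.and h2).and h).and hle).filter_mono nhdsWithin_le_nhds).and
        (self_mem_nhdsWithin (a := (0 : ℝ)) (s := Ioi 0))).exists
    have ht : 0 < t := ht
    rw [abs_of_pos ht] at h1 h2
    have h3 := (abs_le.1 h1).1
    have h4 := (abs_le.1 h2).2
    have h5 := h.1 ht.le
    nlinarith
  · have h2 := hr.def (show 0 < d / 4 by positivity)
    simp only [Real.norm_eq_abs] at h2
    obtain ⟨t, ⟨⟨⟨h1, h2⟩, h⟩, hle⟩, ht⟩ :=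
      (((((h1.and h2).and h).and hle).filter_mono nhdsWithin_le_nhds).and
        (self_mem_nhdsWithin (a := (0 : ℝ)) (s := Iio 0))).exists
    have ht : t < 0 := ht
    rw [abs_of_neg ht] at h1 h2
    have h3 := (abs_le.1 h1).2
    have h4 := (abs_le.1 h2).1
    have h5 := h.2 ht.le
    nlinarith

variable {V E : Type*} {G : Multigraph V E} [Fintype E]

lemma abs_wip_le {w w' : E → C(I, ℝ)} {C : ℝ} (h : ∀ e x, |w' e x| ≤ C * w e x)
    (f : E → C(I, ℝ)) : |wip w' f f| ≤ C * wip w f f := by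
  have h1 : ∀ c : ℝ, wip (c • w) f f = c * wip w f f := fun c => by
    simp [wip_apply, Finset.mul_sum]
  rw [abs_le, ← neg_mul, ← h1, ← h1]
  exact ⟨wip_mono (fun e x => by simpa using (abs_le.1 (h e x)).1) f,
    wip_mono (fun e x => by simpa using (abs_le.1 (h e x)).2) f⟩

lemma bForm_add_smul (w w' : E → C(I, ℝ)) (t : ℝ) :
    bForm G (w + t • w') = bForm G w + t • bForm G w' := by
  refine LinearMap.ext₂ fun u v => ?_
  simp [bForm_apply, wip_apply, add_mul, Finset.sum_add_distrib, Finset.mul_sum]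

lemma qForm_add_smul (c c' : E → ℝ) (t : ℝ) :
    qForm G (c + t • c') = qForm G c + t • qForm G c' := by
  refine LinearMap.ext₂ fun u v => ?_
  simp [qForm_apply, add_mul, Finset.sum_add_distrib, Finset.mul_sum, mul_assoc]

omit [Fintype E] in
/-- The density as a continuous function on every edge. -/
lemma exists_continuousMap {ρ : EdgeFun E} (hρ : IsDensity ρ) :
    ∃ R : E → C(I, ℝ), (∀ e x, R e x = ρ e x) ∧ ∀ e, ContDiffOn ℝ ∞ (ext (R e)) (Icc 0 1) := by
  have hc : ∀ e, Continuous (ρ e) := fun e => by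
    have := continuousOn_iff_continuous_domRestrict.1 (hρ.2 e).continuousOn
    have h2 : (Icc (0 : ℝ) 1).domRestrict (onEdge ρ e) = ρ e :=
      funext fun x => IccExtend_val _ _ x
    rwa [h2] at this
  exact ⟨fun e => ⟨ρ e, hc e⟩, fun _ _ => rfl, hρ.2⟩

/-- An extremal pair admits no variation, in a direction preserving length times mass to first
order, that moves all the eigenvalues of the cluster in the same direction. -/
theorem not_extremal_of_variation [Finite V] [Nonempty E] (hG : G.Connected) {k : ℕ} (hk : 1 ≤ k)
    {g : E → ℝ} {ρ : EdgeFun E}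
    (h : IsExtremalPair (normalisedEigenvalueDensity G k) g ρ) {R : E → C(I, ℝ)}
    (hR : ∀ e x, R e x = ρ e x) (a : E → ℝ) {η : E → C(I, ℝ)}
    (hη : ∀ e, ContDiffOn ℝ ∞ (ext (η e)) (Icc 0 1))
    (hLM : (∑ e, √(g e)) * (∑ e, √(g e) * intg (η e)) =
      (∑ e, √(g e) * a e) * ∑ e, √(g e) * intg (R e)) {κ : ℝ} (hκ : 0 < κ)
    (hvar : ∀ u ∈ Eig (qForm G fun e => 1 / √(g e)) (bForm G fun e => √(g e) • R e)
        (eigenvalue G k g ρ),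
      ∑ e, a e / √(g e) * intg (der G u e ^ 2)
        - eigenvalue G k g ρ * ∑ e, √(g e) * intg (η e * val G u e ^ 2) =
      κ * ∑ e, √(g e) * intg (val G u e ^ 2)) : False := by
  obtain ⟨hg, hρ, hext⟩ := h
  set l : E → ℝ := fun e => √(g e) with hl
  have hl0 : ∀ e, 0 < l e := fun e => Real.sqrt_pos.2 (hg e)
  have hR0 : ∀ e x, 0 < R e x := fun e x => by rw [hR]; exact hρ.1 e x
  have hw : ∀ e x, (l e • R e) x = √(g e) * ρ e x := fun e x => by simp [hl, hR]
  have hw0 : ∀ e x, 0 < (l e • R e) x := fun e x => by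
    simpa using mul_pos (hl0 e) (hR0 e x)
  have hlam := eigenvalue_eq_lam hg hw hG k
  set q := qForm G fun e => 1 / l e with hq
  set b := bForm G fun e => l e • R e with hb
  set Λ := eigenvalue G k g ρ with hΛ
  have hΛ0 : 0 < Λ := by
    rw [hlam]
    exact (spectral hG hl0 hw0).lam_pos hk (finrank_Eig_zero_le hG hl0 _)
  obtain ⟨m, hm, hmR⟩ := exists_pos_le hR0
  obtain ⟨A, hA0, hAa, hAη⟩ : ∃ A > 0, (∀ e, |a e| ≤ A) ∧ ∀ e x, |η e x| ≤ A := by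
    refine ⟨∑ e, (|a e| + ‖η e‖) + 1, by positivity, fun e => ?_, fun e x => ?_⟩
    · have := Finset.single_le_sum (f := fun e => |a e| + ‖η e‖) (fun e _ => by positivity)
        (Finset.mem_univ e)
      linarith [norm_nonneg (η e)]
    · have := Finset.single_le_sum (f := fun e => |a e| + ‖η e‖) (fun e _ => by positivity)
        (Finset.mem_univ e)
      have h2 := (η e).norm_coe_le_norm x
      rw [Real.norm_eq_abs] at h2
      linarith [abs_nonneg (a e)]
  set ε := min 1 m / A with hε
  have hε0 : 0 < ε := by positivity
  have hsmall : ∀ t ∈ Ioo (-ε) ε, |t| * A < min 1 m := fun t ht => by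
    rw [← lt_div_iff₀ hA0]
    exact abs_lt.2 ht
  have hpa : ∀ t ∈ Ioo (-ε) ε, ∀ e, 0 < 1 + t * a e := fun t ht e => by
    have h1 := (hsmall t ht).trans_le (min_le_left _ _)
    have h2 := mul_le_mul_of_nonneg_left (hAa e) (abs_nonneg t)
    rw [← abs_mul] at h2
    linarith [neg_abs_le (t * a e)]
  have hpη : ∀ t ∈ Ioo (-ε) ε, ∀ e x, 0 < R e x + t * η e x := fun t ht e x => by
    have h1 := (hsmall t ht).trans_le (min_le_right _ _)
    have h2 := mul_le_mul_of_nonneg_left (hAη e x) (abs_nonneg t)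
    rw [← abs_mul] at h2
    linarith [neg_abs_le (t * η e x), hmR e x]
  -- With these choices `1 / √γ` and `√γ * τ` are affine in `t`, and so are both forms.
  let γ : ℝ → E → ℝ := fun t e => g e / (1 + t * a e) ^ 2
  let τ : ℝ → EdgeFun E := fun t e x => (1 + t * a e) * (R e x + t * η e x)
  have hRs : ∀ e, ContDiffOn ℝ ∞ (ext (R e)) (Icc 0 1) := fun e => by
    have : ext (R e) = onEdge ρ e := by
      unfold UnitCalc.ext onEdge
      congr 1
      exact funext fun x => hR e x
    rw [this]
    exact hρ.2 e
  have hτedge : ∀ t e, onEdge (τ t) e =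
      fun x => (1 + t * a e) * (ext (R e) x + t * ext (η e) x) := fun t e => rfl
  have hγ : IsSmoothMetricFamily ε γ := by
    refine ⟨fun t ht e => div_pos (hg e) (pow_pos (hpa t ht e) 2), fun e => ?_⟩
    refine contDiffOn_const.div (by fun_prop) fun t ht => (pow_pos (hpa t ht e) 2).ne'
  have hτ : IsSmoothDensityFamily ε τ := by
    refine ⟨fun t ht => ⟨fun e x => mul_pos (hpa t ht e) (hpη t ht e x), fun e => ?_⟩, fun e => ?_⟩
    · rw [hτedge]
      exact contDiffOn_const.mul ((hRs e).add (contDiffOn_const.mul (hη e)))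
    · simp only [hτedge]
      have h1 : MapsTo (Prod.snd : ℝ × ℝ → ℝ) (Ioo (-ε) ε ×ˢ Icc 0 1) (Icc 0 1) :=
        fun p hp => hp.2
      have h2 := (hRs e).comp (contDiff_snd (𝕜 := ℝ) (n := ∞)).contDiffOn h1
      have h3 := (hη e).comp (contDiff_snd (𝕜 := ℝ) (n := ∞)).contDiffOn h1
      have h4 : ContDiffOn ℝ ∞ (Prod.fst : ℝ × ℝ → ℝ) (Ioo (-ε) ε ×ˢ Icc 0 1) :=
        contDiff_fst.contDiffOn
      exact (contDiffOn_const.add (h4.mul contDiffOn_const)).mul (h2.add (h4.mul h3))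
  have hγ0 : γ 0 = g := by ext e; simp [γ]
  have hτ0 : τ 0 = ρ := by ext e x; simp [τ, hR]
  have hnhds : ∀ᶠ t : ℝ in 𝓝 0, t ∈ Ioo (-ε) ε := Ioo_mem_nhds (by linarith) hε0
  have hsqrt : ∀ t ∈ Ioo (-ε) ε, ∀ e, √(γ t e) = l e / (1 + t * a e) := fun t ht e => by
    rw [Real.sqrt_div (hg e).le, Real.sqrt_sq (hpa t ht e).le]
  set q' := qForm G fun e => a e / l e with hq'
  set b' := bForm G fun e => l e • η e with hb'
  have hqt : ∀ t ∈ Ioo (-ε) ε, (qForm G fun e => 1 / √(γ t e)) = q + t • q' := fun t ht => by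
    rw [hq, hq', ← qForm_add_smul]
    congr 1
    ext e
    have := (hl0 e).ne'
    have := (hpa t ht e).ne'
    rw [hsqrt t ht]
    simp only [Pi.add_apply, Pi.smul_apply, smul_eq_mul]
    field_simp
  have hbt : ∀ t : ℝ, (bForm G fun e => l e • (R e + t • η e)) = b + t • b' := fun t => by
    rw [hb, hb', ← bForm_add_smul]
    congr 1
    ext e x
    simp
    ring
  have hwt : ∀ t ∈ Ioo (-ε) ε, ∀ e x, (l e • (R e + t • η e)) x = √(γ t e) * τ t e x :=
    fun t ht e x => by
      have := (hpa t ht e).ne'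
      rw [hsqrt t ht]
      simp only [τ, ContinuousMap.smul_apply, ContinuousMap.add_apply, smul_eq_mul]
      field_simp
  have hS : ∀ t ∈ Ioo (-ε) ε, Spectral (q + t • q') (b + t • b') := fun t ht => by
    rw [← hqt t ht, ← hbt t]
    exact spectral hG (fun e => Real.sqrt_pos.2 (hγ.1 t ht e)) fun e x => by
      simpa [mul_add] using mul_pos (hl0 e) (hpη t ht e x)
  have hlamt : ∀ t ∈ Ioo (-ε) ε, eigenvalue G k (γ t) (τ t) = lam (q + t • q') (b + t • b') k :=
    fun t ht => by
      rw [eigenvalue_eq_lam (hγ.1 t ht) (hwt t ht) hG, hqt t ht, hbt t]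
  have hq0 : ∀ u, 0 ≤ q u u := qForm_nonneg fun e => (one_div_pos.2 (hl0 e)).le
  have hb0 : ∀ u, 0 ≤ b u u := fun u => wip_nonneg (fun e x => (hw0 e x).le) _
  have hCq : ∀ u, |q' u u| ≤ max A (A / m) * (q u u + b u u) := fun u => by
    have h1 : |q' u u| ≤ A * q u u := abs_wip_le (fun e x => by
      simp only [ContinuousMap.const_apply]
      rw [abs_div, abs_of_pos (hl0 e), mul_one_div]
      exact div_le_div_of_nonneg_right (hAa e) (hl0 e).le) _
    have h2 := mul_le_mul_of_nonneg_right (le_max_left A (A / m)) (hq0 u)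
    have h3 : 0 ≤ max A (A / m) * b u u := mul_nonneg (by positivity) (hb0 u)
    linarith
  have hCb : ∀ u, |b' u u| ≤ max A (A / m) * (q u u + b u u) := fun u => by
    have h1 : |b' u u| ≤ A / m * b u u := abs_wip_le (fun e x => by
      simp only [ContinuousMap.smul_apply, smul_eq_mul]
      rw [abs_mul, abs_of_pos (hl0 e), mul_left_comm]
      refine mul_le_mul_of_nonneg_left ((hAη e x).trans ?_) (hl0 e).le
      rw [div_mul_eq_mul_div, le_div_iff₀ hm]
      exact mul_le_mul_of_nonneg_left (hmR e x) hA0.le) _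
    have h2 := mul_le_mul_of_nonneg_right (le_max_right A (A / m)) (hb0 u)
    have h3 : 0 ≤ max A (A / m) * q u u := mul_nonneg (by positivity) (hq0 u)
    linarith
  obtain ⟨B, hB0, hBR⟩ : ∃ B > 0, ∀ e x, R e x ≤ B := by
    refine ⟨∑ e, ‖R e‖ + 1, by positivity, fun e x => ?_⟩
    have h1 := Finset.single_le_sum (f := fun e => ‖R e‖) (fun e _ => by positivity)
      (Finset.mem_univ e)
    have h2 := (le_abs_self _).trans ((R e).norm_coe_le_norm x)
    linarith
  have hposdef : ∀ v ∈ Eig q b (lam q b k),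
      κ / (B * (1 + Λ)) * (q v v + b v v) ≤ q' v v - lam q b k * b' v v := fun v hv => by
    rw [← hlam] at hv ⊢
    have h1 : q' v v = ∑ e, a e / l e * intg (der G v e ^ 2) := by
      simp only [hq', qForm_apply, sq]
    have h2 : b' v v = ∑ e, l e * intg (η e * val G v e ^ 2) := by
      simp only [hb', bForm_apply, wip_apply, sq, smul_mul_assoc, map_smul, smul_eq_mul, mul_assoc]
    have h3 : b v v ≤ B * ∑ e, l e * intg (val G v e ^ 2) := by
      rw [hb, bForm_apply, wip_apply, Finset.mul_sum]
      refine Finset.sum_le_sum fun e _ => ?_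
      rw [smul_mul_assoc, smul_mul_assoc, map_smul, smul_eq_mul, mul_left_comm]
      refine mul_le_mul_of_nonneg_left ?_ (hl0 e).le
      refine le_of_le_of_eq (intg_mono (g := B • val G v e ^ 2) fun x => ?_)
        (map_smul intg B (val G v e ^ 2))
      simp only [ContinuousMap.mul_apply, ContinuousMap.smul_apply, smul_eq_mul,
        mul_assoc, sq]
      exact mul_le_mul_of_nonneg_right (hBR e x) (mul_self_nonneg _)
    rw [h1, h2, hvar v hv, mem_Eig.1 hv v, div_mul_eq_mul_div, div_le_iff₀ (by positivity)]
    have h4 := mul_le_mul_of_nonneg_left h3 (by positivity : 0 ≤ κ * (1 + Λ))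
    linarith
  obtain ⟨c, hc, hpert⟩ := Spectral.lam_perturb (hnhds.mono hS) (qForm_symm _) (bForm_symm _)
    hCq hCb k (by positivity) hposdef
  let Φ : ℝ → ℝ := fun t => (Λ + c * t) * (∑ e, l e / (1 + t * a e)) *
    ∑ e, l e * (intg (R e) + t * intg (η e))
  have hL0 : 0 < ∑ e, l e := Finset.sum_pos (fun e _ => hl0 e) Finset.univ_nonempty
  have hM0 : 0 < ∑ e, l e * intg (R e) := Finset.sum_pos (fun e _ => mul_pos (hl0 e)
    (intg_pos (fun x => (hR0 e x).le) fun h0 => (hR0 e 0).ne' (by rw [h0]; rfl)))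
    Finset.univ_nonempty
  have hΦ : HasDerivAt Φ (c * (∑ e, l e) * ∑ e, l e * intg (R e)) 0 := by
    have h1 : HasDerivAt (fun t : ℝ => Λ + c * t) c 0 := by
      simpa using ((hasDerivAt_id (0 : ℝ)).const_mul c).const_add Λ
    have h2 : HasDerivAt (fun t : ℝ => ∑ e, l e / (1 + t * a e)) (∑ e, -(l e * a e)) 0 := by
      refine HasDerivAt.fun_sum fun e _ => ?_
      have h3 : HasDerivAt (fun t : ℝ => 1 + t * a e) (a e) 0 := by
        simpa using ((hasDerivAt_id (0 : ℝ)).mul_const (a e)).const_add 1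
      have := (hasDerivAt_const (0 : ℝ) (l e)).div h3 (by simp)
      refine this.congr_deriv ?_
      simp
    have h3 : HasDerivAt (fun t : ℝ => ∑ e, l e * (intg (R e) + t * intg (η e)))
        (∑ e, l e * intg (η e)) 0 := by
      refine HasDerivAt.fun_sum fun e _ => ?_
      simpa using (((hasDerivAt_id (0 : ℝ)).mul_const (intg (η e))).const_add
        (intg (R e))).const_mul (l e)
    refine ((h1.mul h2).mul h3).congr_deriv ?_
    simp only [Pi.mul_apply, mul_zero, add_zero, zero_mul, div_one, Finset.sum_neg_distrib]
    -- `hLM` says that length times mass has derivative zero, so only the slope `c` of the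
    -- eigenvalue bound survives.
    linear_combination Λ * hLM
  have hLt : ∀ t ∈ Ioo (-ε) ε, totalLength (γ t) = ∑ e, l e / (1 + t * a e) := fun t ht =>
    Finset.sum_congr rfl fun e _ => hsqrt t ht e
  have hMt : ∀ t ∈ Ioo (-ε) ε, totalMass (γ t) (τ t) =
      ∑ e, l e * (intg (R e) + t * intg (η e)) := fun t ht => by
    refine Finset.sum_congr rfl fun e _ => ?_
    have h1 : ∫ x in (0 : ℝ)..1, onEdge (τ t) e x = (1 + t * a e) * (intg (R e) + t * intg (η e)) := by
      have : intg ((1 + t * a e) • (R e + t • η e)) =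
          (1 + t * a e) * (intg (R e) + t * intg (η e)) := by
        rw [map_smul, map_add, map_smul, smul_eq_mul, smul_eq_mul]
      rw [← this]
      rfl
    rw [hsqrt t ht, h1]
    have := (hpa t ht e).ne'
    field_simp
  have hmt : ∀ t ∈ Ioo (-ε) ε, 0 < totalLength (γ t) * totalMass (γ t) (τ t) := fun t ht => by
    rw [hLt t ht, hMt t ht]
    refine mul_pos (Finset.sum_pos (fun e _ => div_pos (hl0 e) (hpa t ht e)) Finset.univ_nonempty)
      (Finset.sum_pos (fun e _ => mul_pos (hl0 e) ?_) Finset.univ_nonempty)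
    have : 0 < intg (R e + t • η e) := intg_pos (fun x => (hpη t ht e x).le) fun h0 =>
      (hpη t ht e 0).ne' (DFunLike.congr_fun h0 0)
    simpa using this
  refine not_le_or_ge_of_hasDerivAt (F := fun t => normalisedEigenvalueDensity G k (γ t) (τ t))
    (by positivity) hΦ (F₀ := normalisedEigenvalueDensity G k g ρ) ?_ ?_
    (hext ε hε0 γ τ hγ hτ hγ0 hτ0)
  · have h1 := hLt 0 ⟨by linarith, hε0⟩
    have h2 := hMt 0 ⟨by linarith, hε0⟩
    rw [hγ0] at h1 h2
    rw [hτ0] at h2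
    rw [normalisedEigenvalueDensity, h1, h2]
    simp only [Φ, mul_zero, add_zero]
    rfl
  · filter_upwards [hnhds, hpert] with t ht hp
    have hpos := hmt t ht
    rw [← hlam] at hp
    simp only [Φ, normalisedEigenvalueDensity]
    rw [← hLt t ht, ← hMt t ht, hlamt t ht, mul_assoc, mul_assoc]
    exact ⟨fun h0 => mul_le_mul_of_nonneg_right (hp.1 h0) hpos.le,
      fun h0 => mul_le_mul_of_nonneg_right (hp.2 h0) hpos.le⟩

end GraphForm

/-! ### Identities for solutions on an edge -/

namespace UnitCalc

/-- Smoothness up to the boundary of a function on `[0,1]`. -/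
def Smooth (f : C(I, ℝ)) : Prop := ContDiffOn ℝ ∞ (ext f) (Icc 0 1)

namespace Smooth

variable {f g : C(I, ℝ)}

lemma add (hf : Smooth f) (hg : Smooth g) : Smooth (f + g) := ContDiffOn.add hf hg

lemma sub (hf : Smooth f) (hg : Smooth g) : Smooth (f - g) := ContDiffOn.sub hf hg

lemma mul (hf : Smooth f) (hg : Smooth g) : Smooth (f * g) := ContDiffOn.mul hf hg

lemma smul (c : ℝ) (hf : Smooth f) : Smooth (c • f) := contDiffOn_const.smul hf

lemma const (c : ℝ) : Smooth (ContinuousMap.const I c) := contDiffOn_const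

lemma pow (hf : Smooth f) (n : ℕ) : Smooth (f ^ n) := ContDiffOn.pow hf n

lemma coord : Smooth coord := contDiffOn_id.congr fun x hx => by rw [ext_of_mem _ hx]; rfl

lemma exists_isDer (hf : Smooth f) : ∃ f', IsDer f f' ∧ Smooth f' :=
  UnitCalc.exists_isDer (n := ∞) (by simpa [Smooth] using hf)

end Smooth

lemma IsDer.pow {f f' : C(I, ℝ)} (h : IsDer f f') (n : ℕ) :
    IsDer (f ^ (n + 1)) (((n : ℝ) + 1) • (f ^ n * f')) := by
  induction n with
  | zero => simpa using h
  | succ n ih =>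
    rw [pow_succ f (n + 1)]
    refine (ih.mul h).congr ?_
    ext x
    simp
    ring

/-- The function `x (1 - x)`. -/
def bump : C(I, ℝ) := coord - coord ^ 2

lemma bump_apply (x : I) : bump x = x - (x : ℝ) ^ 2 := rfl

lemma bump_zero : bump 0 = 0 := by simp [bump_apply]

lemma bump_one : bump 1 = 0 := by simp [bump_apply]

lemma bump_nonneg (x : I) : 0 ≤ bump x := by
  rw [bump_apply]
  nlinarith [x.2.1, x.2.2]

lemma smooth_bump : Smooth bump := Smooth.coord.sub (Smooth.coord.pow 2)

lemma isDer_bump : IsDer bump (1 - (2 : ℝ) • coord) := by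
  have := isDer_coord.sub (isDer_coord.pow 1)
  refine this.congr ?_
  ext x
  simp
  norm_num

lemma exists_deriv_bump_pow_mul (n : ℕ) {h : C(I, ℝ)} (hh : Smooth h) :
    ∃ h', Smooth h' ∧ IsDer (bump ^ (n + 1) * h) (bump ^ n * h') := by
  obtain ⟨h₁, hd, hs⟩ := hh.exists_isDer
  refine ⟨((n : ℝ) + 1) • ((1 - (2 : ℝ) • coord) * h) + bump * h₁, ?_, ?_⟩
  · exact ((((Smooth.const 1).sub (Smooth.coord.smul 2)).mul hh).smul _).add (smooth_bump.mul hs)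
  · refine ((isDer_bump.pow n).mul hd).congr ?_
    ext x
    simp
    ring

/-- A solution of `f'' = -c ρ f` satisfies a third-order identity for `f ^ 2`. -/
lemma intg_mul_sq_eq_zero {f f' ρ ρ' ψ ψ₁ ψ₂ ψ₃ : C(I, ℝ)} {c : ℝ} (hf : IsDer f f')
    (hf' : IsDer f' (-(c • (ρ * f)))) (hρ : IsDer ρ ρ') (h0 : IsDer ψ ψ₁) (h1 : IsDer ψ₁ ψ₂)
    (h2 : IsDer ψ₂ ψ₃) (hψ : ψ 0 = 0 ∧ ψ 1 = 0) (hψ₁ : ψ₁ 0 = 0 ∧ ψ₁ 1 = 0)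
    (hψ₂ : ψ₂ 0 = 0 ∧ ψ₂ 1 = 0) :
    intg ((ψ₃ + (4 * c) • (ρ * ψ₁) + (2 * c) • (ρ' * ψ)) * f ^ 2) = 0 := by
  -- These are the boundary terms left by integrating `(f²)''' + 4cρ(f²)' + 2cρ'f²` by parts against
  -- `ψ`.
  have hJ : IsDer (f * f * ψ₂ - (2 : ℝ) • (f * f' * ψ₁) +
      (2 : ℝ) • ((f' * f' + c • (ρ * f * f)) * ψ))
      ((ψ₃ + (4 * c) • (ρ * ψ₁) + (2 * c) • (ρ' * ψ)) * f ^ 2) := by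
    refine (((((hf.mul hf).mul h2).sub (((hf.mul hf').mul h1).smul 2))).add
      ((((hf'.mul hf').add (((hρ.mul hf).mul hf).smul c)).mul h0).smul 2)).congr ?_
    ext x
    simp
    ring
  rw [hJ.intg_eq]
  simp [hψ.1, hψ.2, hψ₁.1, hψ₁.2, hψ₂.1, hψ₂.2]

/-- Solutions of `f'' = -c f` on an edge: the Dirichlet energy is a weighted mass, with a smooth
weight of integral `c`. -/
lemma exists_energy_weight (c : ℝ) : ∃ θ : C(I, ℝ), Smooth θ ∧ intg θ = c ∧
    ∀ f f' : C(I, ℝ), IsDer f f' → IsDer f' (-(c • f)) → intg (f' ^ 2) = intg (θ * f ^ 2) := by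
  set z : C(I, ℝ) := 1 - (2 : ℝ) • coord with hz
  -- The factor `30` gives `χ` integral one; the square makes `χ` and `χ'` vanish at both ends. `X`
  -- is the primitive of `χ`, running from `0` to `1`.
  set χ : C(I, ℝ) := (30 : ℝ) • bump ^ 2 with hχ
  set χ₁ : C(I, ℝ) := (60 : ℝ) • (bump * z) with hχ₁
  set χ₂ : C(I, ℝ) := (60 : ℝ) • (z ^ 2 - (2 : ℝ) • bump) with hχ₂
  set X : C(I, ℝ) := (10 : ℝ) • coord ^ 3 - (15 : ℝ) • coord ^ 4 + (6 : ℝ) • coord ^ 5 with hX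
  have hzd : IsDer z (-(ContinuousMap.const I 2)) := by
    refine ((IsDer.const 1).sub (isDer_coord.smul 2)).congr ?_
    ext x; simp
  have h0 : IsDer χ χ₁ := by
    refine ((isDer_bump.pow 1).smul 30).congr ?_
    ext x; simp [hχ₁, hz]; ring
  have h1 : IsDer χ₁ χ₂ := by
    refine ((isDer_bump.mul hzd).smul 60).congr ?_
    ext x; simp [hχ₂, hz]; ring
  have h2 : IsDer X χ := by
    refine ((((isDer_coord.pow 2).smul 10).sub ((isDer_coord.pow 3).smul 15)).add
      ((isDer_coord.pow 4).smul 6)).congr ?_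
    ext x; simp [hχ, bump_apply]; ring
  have hX0 : X 0 = 0 := by simp [hX]
  have hX1 : X 1 = 1 := by simp [hX]; norm_num
  have hχb : χ 0 = 0 ∧ χ 1 = 0 := by simp [hχ, bump_zero, bump_one]
  have hχ₁b : χ₁ 0 = 0 ∧ χ₁ 1 = 0 := by simp [hχ₁, bump_zero, bump_one]
  have hzs : Smooth z := (Smooth.const 1).sub (Smooth.coord.smul 2)
  refine ⟨(1 / 2 : ℝ) • χ₂ + (2 * c) • χ - ContinuousMap.const I c, ?_, ?_, fun f f' hf hf' => ?_⟩
  · exact ((((((hzs.pow 2).sub (smooth_bump.smul 2))).smul 60).smul _).add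
      (((smooth_bump.pow 2).smul 30).smul _)).sub (Smooth.const c)
  · rw [map_sub, map_add, map_smul intg _ χ₂, map_smul intg _ χ, h1.intg_eq, h2.intg_eq, intg_const, hX0, hX1,
      hχ₁b.1, hχ₁b.2]
    simp
    ring
  -- As `f'² + cf²` is constant, its integral equals that against `χ`; integrating `χ f'²` by parts
  -- twice then leaves only multiples of `f²`.
  · have hK : IsDer ((coord - X) * (f' * f' + c • (f * f)) - (1 / 2 : ℝ) • (χ₁ * (f * f)) +
        χ * (f * f')) (f' ^ 2 - ((1 / 2 : ℝ) • χ₂ + (2 * c) • χ - ContinuousMap.const I c) * f ^ 2) := by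
      refine ((((isDer_coord.sub h2).mul ((hf'.mul hf').add ((hf.mul hf).smul c))).sub
        ((h1.mul (hf.mul hf)).smul (1 / 2))).add (h0.mul (hf.mul hf'))).congr ?_
      ext x
      simp
      ring
    have := hK.intg_eq
    rw [map_sub] at this
    rw [← sub_eq_zero, this]
    simp [hX0, hX1, hχb.1, hχb.2, hχ₁b.1, hχ₁b.2]

end UnitCalc

/-! ### Extremal densities are constant -/

namespace GraphForm

open UnitCalc FormPair QuantumGraph

variable {V E : Type*} {G : Multigraph V E} [Fintype E]

lemma isDer_der_of_mem_Eig [Finite V] (hG : G.Connected) {g : E → ℝ} (hg : IsMetric g)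
    {R : E → C(I, ℝ)} {ν : ℝ} {u : Dom G}
    (hu : u ∈ Eig (qForm G fun e => 1 / √(g e)) (bForm G fun e => √(g e) • R e) ν) (e : E) :
    IsDer (der G u e) (-((ν * g e) • (R e * val G u e))) := by
  refine ((isSol_of_mem_Eig hg hG hu).1 e).congr ?_
  have := Real.mul_self_sqrt (hg e).le
  ext x
  simp
  linear_combination ν * R e x * val G u e x * this

lemma eigenvalue_pos [Finite V] [Nonempty E] (hG : G.Connected) {k : ℕ} (hk : 1 ≤ k)
    {g : E → ℝ} {ρ : EdgeFun E} (hg : IsMetric g) (hρ : IsDensity ρ) {R : E → C(I, ℝ)}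
    (hR : ∀ e x, R e x = ρ e x) : 0 < eigenvalue G k g ρ := by
  have hl0 : ∀ e, 0 < √(g e) := fun e => Real.sqrt_pos.2 (hg e)
  have hw : ∀ e x, (√(g e) • R e) x = √(g e) * ρ e x := fun e x => by simp [hR]
  rw [eigenvalue_eq_lam hg hw hG k]
  exact (spectral hG hl0 fun e x => by rw [hw]; exact mul_pos (hl0 e) (hρ.1 e x)).lam_pos hk
    (finrank_Eig_zero_le hG hl0 _)

lemma sum_smul_sub_const (c d : E → ℝ) (η : E → C(I, ℝ)) (f : E → C(I, ℝ)) (κ : ℝ) :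
    ∑ e, c e * intg ((d e • η e - ContinuousMap.const I κ) * f e) =
      ∑ e, c e * d e * intg (η e * f e) - κ * ∑ e, c e * intg (f e) := by
  rw [Finset.mul_sum, ← Finset.sum_sub_distrib]
  refine Finset.sum_congr rfl fun e _ => ?_
  have : (d e • η e - ContinuousMap.const I κ) * f e = d e • (η e * f e) - κ • f e := by
    ext x; simp; ring
  rw [this, map_sub, map_smul, map_smul, smul_eq_mul, smul_eq_mul]
  ring

theorem exists_edgewise_constant [Finite V] [Nonempty E] (hG : G.Connected) {k : ℕ} (hk : 1 ≤ k)
    {g : E → ℝ} {ρ : EdgeFun E}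
    (h : IsExtremalPair (normalisedEigenvalueDensity G k) g ρ) {R : E → C(I, ℝ)}
    (hR : ∀ e x, R e x = ρ e x) (hRs : ∀ e, Smooth (R e)) (e₀ : E) (x y : I) :
    R e₀ x = R e₀ y := by
  have hg := h.1
  have hl0 : ∀ e, 0 < √(g e) := fun e => Real.sqrt_pos.2 (hg e)
  have hΛ := eigenvalue_pos hG hk hg h.2.1 hR
  set Λ := eigenvalue G k g ρ
  choose R₁ hR₁ hR₁s using fun e => (hRs e).exists_isDer
  choose h₁ hh₁ hd₁ using fun e => exists_deriv_bump_pow_mul 2 (hR₁s e)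
  choose h₂ hh₂ hd₂ using fun e => exists_deriv_bump_pow_mul 1 (hh₁ e)
  choose h₃ hh₃ hd₃ using fun e => exists_deriv_bump_pow_mul 0 (hh₂ e)
  let S : E → C(I, ℝ) := fun e => bump ^ 3 * R₁ e * R₁ e
  have hS0 : ∀ e x, 0 ≤ S e x := fun e x => by
    simp only [S, ContinuousMap.mul_apply, ContinuousMap.pow_apply, mul_assoc]
    exact mul_nonneg (pow_nonneg (bump_nonneg x) 3) (mul_self_nonneg _)
  -- This is `ψ''' + 4cρψ' + 2cρ'ψ` for `ψ = bump ^ 3 * ρ'` and `c = Λ * g e`; the cube makes `ψ`,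
  -- `ψ'` and `ψ''` vanish at both ends.
  let η : E → C(I, ℝ) := fun e => bump ^ 0 * h₃ e + (4 * (Λ * g e)) • (R e * (bump ^ 2 * h₁ e)) +
    (2 * (Λ * g e)) • (R₁ e * (bump ^ 3 * R₁ e))
  have hηint : ∀ e, intg (η e) = -(2 * (Λ * g e)) * intg (S e) := fun e => by
    have e1 := (hd₃ e).intg_eq
    have e2 := ((hR₁ e).mul (hd₁ e)).intg_eq
    rw [map_add] at e2
    simp only [ContinuousMap.mul_apply, ContinuousMap.pow_apply, bump_zero, bump_one] at e1 e2
    norm_num at e1 e2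
    have e3 : intg (R₁ e * (bump ^ 3 * R₁ e)) = intg (S e) := by
      congr 1; ext x; simp [S]; ring
    simp only [η]
    rw [map_add, map_add, map_smul, map_smul, e3, smul_eq_mul, smul_eq_mul, pow_zero, one_mul]
    rw [e3] at e2
    rw [e1]
    linear_combination 4 * (Λ * g e) * e2
  have hηf : ∀ u ∈ Eig (qForm G fun e => 1 / √(g e)) (bForm G fun e => √(g e) • R e) Λ, ∀ e,
      intg (η e * val G u e ^ 2) = 0 := fun u hu e =>
    intg_mul_sq_eq_zero (isDer u e) (isDer_der_of_mem_Eig hG hg hu e) (hR₁ e) (hd₁ e) (hd₂ e)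
      (hd₃ e) (by simp [bump_zero, bump_one]) (by simp [bump_zero, bump_one])
      (by simp [bump_zero, bump_one])
  have hL0 : 0 < ∑ e, √(g e) := Finset.sum_pos (fun e _ => hl0 e) Finset.univ_nonempty
  have hTnn : ∀ e, 0 ≤ √(g e) * (2 * (Λ * g e) * intg (S e)) := fun e =>
    mul_nonneg (hl0 e).le (mul_nonneg (by have := hg e; positivity) (intg_nonneg (hS0 e)))
  have hT : ∑ e, √(g e) * (2 * (Λ * g e) * intg (S e)) = 0 := by
    by_contra hne
    have hpos := lt_of_le_of_ne (Finset.sum_nonneg fun e _ => hTnn e) (Ne.symm hne)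
    set T := ∑ e, √(g e) * (2 * (Λ * g e) * intg (S e)) with hTdef
    -- Lengths stay fixed. Moving along `-η` adds mass at rate `T` without affecting the eigenspace;
    -- the constant removes that mass and alone contributes to the first variation, positively.
    refine not_extremal_of_variation hG hk h hR 0
      (η := fun e => (-1 : ℝ) • η e - ContinuousMap.const I (T / ∑ e, √(g e))) (fun e => ?_) ?_
      (κ := Λ * (T / ∑ e, √(g e))) (by positivity) fun u hu => ?_
    · have hηs : Smooth (η e) := ((((smooth_bump.pow 0).mul (hh₃ e)).add
        (((hRs e).mul ((smooth_bump.pow 2).mul (hh₁ e))).smul _))).add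
        (((hR₁s e).mul ((smooth_bump.pow 3).mul (hR₁s e))).smul _)
      exact (hηs.smul _).sub (Smooth.const _)
    · have h1 := sum_smul_sub_const (fun e => √(g e)) (fun _ => -1) η (fun _ => 1)
        (T / ∑ e, √(g e))
      have h2 : intg 1 = 1 := intg_const 1
      simp only [mul_one, h2, hηint] at h1
      rw [h1, div_mul_cancel₀ _ hL0.ne']
      have h3 : ∑ e, √(g e) * -1 * (-(2 * (Λ * g e)) * intg (S e)) = T :=
        Finset.sum_congr rfl fun e _ => by ring
      rw [h3]
      simp
    · have h1 := sum_smul_sub_const (fun e => √(g e)) (fun _ => -1) η (fun e => val G u e ^ 2)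
        (T / ∑ e, √(g e))
      simp only [hηf u hu] at h1
      rw [h1]
      simp
      ring
  rw [Finset.sum_eq_zero_iff_of_nonneg fun e _ => hTnn e] at hT
  have h1 := hT e₀ (Finset.mem_univ e₀)
  have h2 : intg (S e₀) = 0 := by
    have := hl0 e₀
    have := hg e₀
    by_contra hne
    exact (mul_ne_zero (hl0 e₀).ne' (mul_ne_zero (by positivity) hne)) h1
  have h3 := eq_zero_of_intg_eq_zero (hS0 e₀) h2
  have h4 : ∀ x ∈ Ioo (0 : ℝ) 1, ext (R₁ e₀) x = 0 := fun x hx => by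
    rw [ext_of_mem _ (Ioo_subset_Icc_self hx)]
    have h5 := DFunLike.congr_fun h3 ⟨x, Ioo_subset_Icc_self hx⟩
    have h6 : bump ⟨x, Ioo_subset_Icc_self hx⟩ ≠ 0 := by
      rw [bump_apply]
      change x - x ^ 2 ≠ 0
      have : 0 < x * (1 - x) := mul_pos hx.1 (sub_pos.2 hx.2)
      nlinarith
    simpa [S, h6] using h5
  have h5 : R₁ e₀ = 0 := by
    have hcl : IsClosed {x : ℝ | ext (R₁ e₀) x = 0} :=
      isClosed_eq (continuous_ext _) continuous_const
    have h6 := closure_minimal (show Ioo (0 : ℝ) 1 ⊆ _ from h4) hcl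
    rw [closure_Ioo zero_ne_one] at h6
    ext x
    rw [← ext_coe]
    exact h6 x.2
  have h6 := hR₁ e₀
  rw [h5] at h6
  exact h6.eq_of_deriv_zero x y

theorem density_constant [Finite V] [Nonempty E] (hG : G.Connected) {k : ℕ} (hk : 1 ≤ k)
    {g : E → ℝ} {ρ : EdgeFun E}
    (h : IsExtremalPair (normalisedEigenvalueDensity G k) g ρ) :
    ∃ c : ℝ, ∀ e x, ρ e x = c := by
  obtain ⟨R, hR, hRs⟩ := exists_continuousMap h.2.1
  have hg := h.1
  have hl0 : ∀ e, 0 < √(g e) := fun e => Real.sqrt_pos.2 (hg e)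
  have hΛ := eigenvalue_pos hG hk hg h.2.1 hR
  set Λ := eigenvalue G k g ρ
  have hconst : ∀ e, R e = ContinuousMap.const I (R e 0) := fun e => by
    ext x
    exact exists_edgewise_constant hG hk h hR hRs e x 0
  set r : E → ℝ := fun e => R e 0 with hr
  have hRint : ∀ e, intg (R e) = r e := fun e => by rw [hconst, intg_const]
  set L := ∑ e, √(g e) with hL
  set M := ∑ e, √(g e) * r e with hM
  have hL0 : 0 < L := Finset.sum_pos (fun e _ => hl0 e) Finset.univ_nonempty
  choose θ hθs hθi hθ using fun e => exists_energy_weight (Λ * g e * r e)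
  set T := ∑ e, √(g e) * (L * r e - M) ^ 2 with hT
  have hTnn : ∀ e, 0 ≤ √(g e) * (L * r e - M) ^ 2 := fun e =>
    mul_nonneg (hl0 e).le (sq_nonneg _)
  have hT0 : T = 0 := by
    by_contra hne
    have hpos : 0 < T := lt_of_le_of_ne (Finset.sum_nonneg fun e _ => hTnn e) (Ne.symm hne)
    -- For any `a`, the density change `a e / (Λ * g e) • θ e` cancels the effect of `a` on the
    -- eigenspace, while length times mass changes at rate `∑ √(g e) * a e * (L * r e - M)`. This
    -- `a` makes the rate `T`, and the constant `T / L ^ 2` removes it.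
    refine not_extremal_of_variation hG hk h hR (fun e => L * r e - M)
      (η := fun e => ((L * r e - M) / (Λ * g e)) • θ e - ContinuousMap.const I (T / L ^ 2))
      (fun e => ((hθs e).smul _).sub (Smooth.const _)) ?_
      (κ := Λ * (T / L ^ 2)) (by positivity) fun u hu => ?_
    · have h1 := sum_smul_sub_const (fun e => √(g e)) (fun e => (L * r e - M) / (Λ * g e)) θ
        (fun _ => 1) (T / L ^ 2)
      have h2 : intg 1 = 1 := intg_const 1
      simp only [mul_one, h2, hθi] at h1
      have h3 : ∑ e, √(g e) * ((L * r e - M) / (Λ * g e)) * (Λ * g e * r e) =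
          ∑ e, √(g e) * (L * r e - M) * r e := Finset.sum_congr rfl fun e _ => by
        have := (hg e).ne'
        field_simp
      rw [h1, h3, ← hL]
      simp only [hRint]
      rw [← hM]
      have h4 : T = L * ∑ e, √(g e) * (L * r e - M) * r e - (∑ e, √(g e) * (L * r e - M)) * M := by
        rw [hT, Finset.mul_sum, Finset.sum_mul, ← Finset.sum_sub_distrib]
        exact Finset.sum_congr rfl fun e _ => by ring
      have h5 : L * (T / L ^ 2 * L) = T := by field_simp
      linear_combination -h4 - h5
    · have h1 := sum_smul_sub_const (fun e => √(g e)) (fun e => (L * r e - M) / (Λ * g e)) θ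
        (fun e => val G u e ^ 2) (T / L ^ 2)
      rw [h1]
      have h2 : ∀ e, intg (der G u e ^ 2) = intg (θ e * val G u e ^ 2) := fun e => by
        refine hθ e _ _ (isDer u e) ((isDer_der_of_mem_Eig hG hg hu e).congr ?_)
        rw [hconst e]
        ext x
        simp [hr]
        ring
      have h3 : ∑ e, (L * r e - M) / √(g e) * intg (der G u e ^ 2) = Λ *
          ∑ e, √(g e) * ((L * r e - M) / (Λ * g e)) * intg (θ e * val G u e ^ 2) := by
        rw [Finset.mul_sum]
        refine Finset.sum_congr rfl fun e _ => ?_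
        rw [h2]
        have h4 := (hl0 e).ne'
        have h5 := Real.mul_self_sqrt (hg e).le
        rw [← h5]
        field_simp
        rw [Real.sqrt_sq (hl0 e).le]
      rw [h3]
      ring
  rw [hT, Finset.sum_eq_zero_iff_of_nonneg fun e _ => hTnn e] at hT0
  refine ⟨M / L, fun e x => ?_⟩
  have h1 := (mul_eq_zero.1 (hT0 e (Finset.mem_univ e))).resolve_left (hl0 e).ne'
  have h2 := pow_eq_zero_iff two_ne_zero |>.1 h1
  rw [← hR, exists_edgewise_constant hG hk h hR hRs e x 0, eq_div_iff hL0.ne']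
  linear_combination h2

end GraphForm

/-! ### Constant densities -/

namespace QuantumGraph

variable {V E : Type*} [Fintype E]

lemma eigenspace_const (G : Multigraph V E) (g : E → ℝ) (c μ : ℝ) :
    eigenspace G g (fun _ _ => c) μ = eigenspace G g (fun _ _ => 1) (c * μ) := by
  ext f
  change (_ ∧ (∀ e, ∀ x : I, _ = μ * c * f e x) ∧ _) ↔ (_ ∧ (∀ e, ∀ x : I, _ = c * μ * 1 * f e x) ∧ _)
  simp only [mul_one, mul_comm c μ]

lemma eigenvalue_const (G : Multigraph V E) (k : ℕ) (g : E → ℝ) {c : ℝ} (hc : 0 < c) :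
    eigenvalue G k g (fun _ _ => c) = c⁻¹ * eigenvalue G k g (fun _ _ => 1) := by
  have key : ∀ μ, (⨆ ν ∈ Iic μ, eigenspace G g (fun _ _ => c) ν) =
      ⨆ ν ∈ Iic (c * μ), eigenspace G g (fun _ _ => 1) ν := fun μ => by
    refine le_antisymm (iSup₂_le fun ν hν => ?_) (iSup₂_le fun ν hν => ?_)
    · rw [eigenspace_const]
      exact le_iSup₂_of_le (c * ν) (mul_le_mul_of_nonneg_left hν hc.le) le_rfl
    · refine le_iSup₂_of_le (c⁻¹ * ν) ?_ ?_
      · rw [mem_Iic, inv_mul_le_iff₀ hc]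
        exact hν
      · rw [eigenspace_const G g c, mul_inv_cancel_left₀ hc.ne']
  unfold eigenvalue
  rw [← smul_eq_mul, ← Real.sInf_smul_of_nonneg (inv_nonneg.2 hc.le)]
  congr 1
  ext μ
  rw [mem_inv_smul_set_iff₀ hc.ne', mem_ofPred_eq, mem_ofPred_eq, key, smul_eq_mul]

/-- The eigenvalue scales by `c⁻¹` and the mass by `c`. -/
lemma normalisedEigenvalueDensity_const (G : Multigraph V E) (k : ℕ) (g : E → ℝ) {c : ℝ}
    (hc : 0 < c) :
    normalisedEigenvalueDensity G k g (fun _ _ => c) = normalisedEigenvalue G k g := by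
  have h1 : totalMass g (fun _ _ => c) = c * totalLength g := by
    have : ∀ e, onEdge (fun (_ : E) (_ : I) => c) e = fun _ => c := fun e => rfl
    simp only [totalMass, totalLength, this, Finset.mul_sum]
    refine Finset.sum_congr rfl fun e _ => ?_
    simp [mul_comm]
  rw [normalisedEigenvalueDensity, normalisedEigenvalue, eigenvalue_const G k g hc, h1]
  field_simp

end QuantumGraph

theorem mainTheorem7 {V E : Type*} [Finite V] [Fintype E] (G : Multigraph V E)
    (hG : G.Connected) (k : ℕ) (hk : 1 ≤ k) (g : E → ℝ) (ρ : QuantumGraph.EdgeFun E)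
    (h : QuantumGraph.IsExtremalPair (QuantumGraph.normalisedEigenvalueDensity G k) g ρ) :
    (∃ c : ℝ, ∀ e x, ρ e x = c) ∧
      QuantumGraph.IsExtremalMetric (QuantumGraph.normalisedEigenvalue G k) g := by
  obtain ⟨c, hc, hρc⟩ : ∃ c : ℝ, 0 < c ∧ ∀ e x, ρ e x = c := by
    rcases isEmpty_or_nonempty E with hE | hE
    · exact ⟨1, one_pos, fun e => hE.elim e⟩
    · obtain ⟨c, hc⟩ := GraphForm.density_constant hG hk h
      exact ⟨c, hc (Classical.arbitrary E) 0 ▸ h.2.1.1 _ _, hc⟩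
  refine ⟨⟨c, hρc⟩, h.1, fun ε hε γ hγ hγ0 => ?_⟩
  obtain rfl : ρ = fun _ _ => c := by ext e x; exact hρc e x
  -- Only the metric varies: keeping the density equal to `c` reduces the claim to extremality of
  -- the pair.
  have := h.2.2 ε hε γ (fun _ _ _ => c) hγ
    ⟨fun _ _ => h.2.1, fun _ => contDiffOn_const⟩ hγ0 rfl
  simpa only [QuantumGraph.normalisedEigenvalueDensity_const G k _ hc] using this

end
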